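/- **Setting.** Let $(\Omega,\mathcal F_T,(\mathcal F_s)_{s=0}^T,\mathbb P)$ be a filtered probability space, $t\in\{0,\dots,T\}$, $d\in\mathbb N$, $p\in[1,\infty]$ and $\frac1p+\frac1q=1$. $L^p_d(\mathcal F_s)$ is the space of (classes of) $p$-integrable $\mathcal F_s$-measurable random vectors in $\mathbb R^d$, $L^p_d(\mathcal F_s)_+$ its cone of vectors with a.s. nonnegative components. All topological notions refer to the norm topology if $p<\infty$ and to $\sigma(L^\infty_d,L^1_d)$ if $p=\infty$. Let $M_t$ be a closed linear subspace of $L^p_d(\mathcal F_t)$ (for instance $M_t=\{m\in L^p_d(\mathcal F_t): m\in\tilde M_t \text{ a.s.}\}$ for a random subspace $\tilde M_t$ of $\mathbb R^d$) with $(M_t)_+:=M_t\cap L^p_d(\mathcal F_t)_+\neq\{0\}$, and let $$\mathcal G(M_t;(M_t)_+)=\{D\subseteq M_t:\ D=\operatorname{cl}\operatorname{co}(D+(M_t)_+)\}.$$ **Risk measures.** $R_t:L^p_d(\mathcal F_T)\to\mathcal G(M_t;(M_t)_+)$ is a *conditional risk measure* if $R_t(X+m)=R_t(X)-m$ for $m\in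 M_t$; $R_t(Y)\supseteq R_t(X)$ if $Y-X\in L^p_d(\mathcal F_T)_+$; and $\emptyset\ne R_t(0)\neq M_t$. It is *convex* if $R_t(\lambda X+(1-\lambda)Y)\supseteq\lambda R_t(X)+(1-\lambda)R_t(Y)$ for all $X,Y$ and $\lambda\in[0,1]$, and *closed* if its graph $\{(X,u)\in L^p_d(\mathcal F_T)\times M_t: u\in R_t(X)\}$ is closed. Its acceptance set is $A_{R_t}=\{X: 0\in R_t(X)\}$. **Dual variables.** Let $M_t^\perp=\{v\in L^q_d(\mathcal F_t):\mathbb E[v^{\mathsf T}u]=0\ \forall u\in M_t\}$, $(M_t)_+^+=\{v\in L^q_d(\mathcal F_t):\mathbb E[v^{\mathsf T}u]\ge0\ \forall u\in (M_t)_+\}$ and $G_t(w)=\{x\in L^p_d(\mathcal F_t):0\le\mathbb E[w^{\mathsf T}x]\}$. For a vector $\mathbb Q=(\mathbb Q_1,\dots,\mathbb Q_d)$ of probability measures on $(\Omega,\mathcal F_T)$ that are absolutely continuous with respect to $\mathbb P$ let $\xi^{\mathbb Q}=\operatorname{diag}(\mathbb E[\frac{d\mathbb Q}{d\mathbb P}|\mathcal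 F_t])^{-1}\frac{d\mathbb Q}{d\mathbb P}$, where the $i$-th component is read as $1$ on $\{\mathbb E[\frac{d\mathbb Q_i}{d\mathbb P}|\mathcal F_t]=0\}$, and let $\mathbb E^{\mathbb Q}[X|\mathcal F_t]=\mathbb E[\operatorname{diag}(\xi^{\mathbb Q})X|\mathcal F_t]$. This is a generalized conditional expectation: its $i$-th component is $\mathbb E[(\xi^{\mathbb Q}_iX_i)^+|\mathcal F_t]-\mathbb E[(\xi^{\mathbb Q}_iX_i)^-|\mathcal F_t]$, where infinite terms are replaced by $0$; for the pairs $(\mathbb Q,w)$ below they occur only where $w_i=0$. Set $$\mathcal W_t^q=\Big\{(\mathbb Q,w):\ w\in(M_t)_+^+\setminus M_t^\perp,\ \operatorname{diag}(w)\,\xi^{\mathbb Q}\in L^q_d(\mathcal F_T)_+\Big\},$$ and, for $(\mathbb Q,w)\in\mathcal W^q_t$ and $X\in L^p_d(\mathcal F_T)$, understand $(\mathbb E^{\mathbb Q}[X|\mathcal F_t]+G_t(w))\cap M_t$ as the set $\{u\in M_t:\mathbb E[w^{\mathsf T}\mathbb E^{\mathbb Q}[X|\mathcal F_t]]\le\mathbb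 E[w^{\mathsf T}u]\}$. A function $-\alpha_t:\mathcal W_t^q\to\mathcal G(M_t;(M_t)_+)$ is a *penalty function* if $\bigcap_{(\mathbb Q,w)\in\mathcal W_t^q}-\alpha_t(\mathbb Q,w)\ne\emptyset$, $-\alpha_t(\mathbb Q,w)\ne M_t$ for at least one $(\mathbb Q,w)\in\mathcal W_t^q$, and $-\alpha_t(\mathbb Q,w)=\operatorname{cl}(-\alpha_t(\mathbb Q,w)+G_t(w))\cap M_t$ for all $(\mathbb Q,w)\in\mathcal W_t^q$. **Theorem.** A function $R_t:L^p_d(\mathcal F_T)\to\mathcal G(M_t;(M_t)_+)$ is a closed convex conditional risk measure if and only if there is a penalty function $-\alpha_t$ such that, for all $X\in L^p_d(\mathcal F_T)$, $$R_t(X)=\bigcap_{(\mathbb Q,w)\in\mathcal W_t^q}\Big[-\alpha_t(\mathbb Q,w)+\big(\mathbb E^{\mathbb Q}[-X|\mathcal F_t]+G_t(w)\big)\cap M_t\Big].\qquad(*)$$ In particular, if $R_t$ is a closed convex conditional risk measure, then $$-\alpha_t^{\min}(\mathbb Q,w)=\operatorname{cl}\bigcup_{Z\in A_{R_t}}\big(\mathbb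 E^{\mathbb Q}[Z|\mathcal F_t]+G_t(w)\big)\cap M_t$$ is a penalty function that satisfies $(*)$, and every penalty function $-\alpha_t$ that satisfies $(*)$ has $-\alpha_t(\mathbb Q,w)\supseteq-\alpha_t^{\min}(\mathbb Q,w)$ for all $(\mathbb Q,w)\in\mathcal W_t^q$. -/

import Mathlib

open MeasureTheory ProbabilityTheory
open scoped ENNReal Topology Pointwise

namespace SetRisk

noncomputable section

/-- The space `ℝ^d` of portfolios. The spaces `L^p_d` and their topologies do not depend on the
choice of the norm of `ℝ^d`; the Euclidean one is used. -/
abbrev Vec (d : ℕ) : Type := EuclideanSpace ℝ (Fin d)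

/-- The space `L^p_d` of (classes of) `p`-integrable random vectors, over the full σ-algebra of
`Ω`, which plays the role of `𝓕_T`. -/
abbrev LpVec {Ω : Type*} [MeasurableSpace Ω] (d : ℕ) (p : ℝ≥0∞) (P : Measure Ω) : Type _ :=
  Lp (Vec d) p P

/-- `L^p_d(m)`, as a subspace of `L^p_d`, for a sub-σ-algebra `m` (which plays the role
of `𝓕_t`). -/
abbrev LpSub {Ω : Type*} (m : MeasurableSpace Ω) [MeasurableSpace Ω] (d : ℕ) (p : ℝ≥0∞)
    (P : Measure Ω) : Submodule ℝ (LpVec d p P) :=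
  lpMeas (Vec d) ℝ m p P

/-- `E[fᵀ g]`. -/
def pairing {Ω : Type*} [MeasurableSpace Ω] {d : ℕ} (P : Measure Ω) (f g : Ω → Vec d) : ℝ :=
  ∫ ω, inner ℝ (f ω) (g ω) ∂P

/-- The weak* topology `σ(L^∞_d, L^1_d)`, defined on `L^p_d` by the functionals `X ↦ E[Xᵀ Y]`,
`Y ∈ L^1_d`; it is used for `p = ∞` only. -/
@[reducible] def weakStar {Ω : Type*} [MeasurableSpace Ω] (d : ℕ) (p : ℝ≥0∞) (P : Measure Ω) :
    TopologicalSpace (LpVec d p P) :=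
  TopologicalSpace.induced
    (fun (X : LpVec d p P) (Y : LpVec d 1 P) => pairing P X Y) inferInstance

open Classical in
/-- The topology of `L^p_d`: the norm topology if `p < ∞`, and `σ(L^∞_d, L^1_d)` if `p = ∞`.
On the subspace `L^p_d(m)` it induces the norm topology, respectively
`σ(L^∞_d(m), L^1_d(m))`, and `L^p_d(m)` is closed, so that closures of subsets of `L^p_d(m)` may be
taken in `L^p_d`. -/
@[reducible] def topo {Ω : Type*} [MeasurableSpace Ω] (d : ℕ) (p : ℝ≥0∞) [Fact (1 ≤ p)] (P : Measure Ω) :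
    TopologicalSpace (LpVec d p P) :=
  if p = ∞ then weakStar d p P else inferInstance

/-- Random vectors in `L^p_d` with almost surely nonnegative components. -/
def nonneg {Ω : Type*} [MeasurableSpace Ω] (d : ℕ) (p : ℝ≥0∞) (P : Measure Ω) :
    Set (LpVec d p P) :=
  {X | ∀ᵐ ω ∂P, ∀ i, 0 ≤ X ω i}

section

variable {Ω : Type*} (m : MeasurableSpace Ω) [mΩ : MeasurableSpace Ω] {d : ℕ} {p q : ℝ≥0∞}
  [Fact (1 ≤ p)] (P : Measure Ω) (M : Submodule ℝ (LpVec d p P))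

/-- The cone `M_+` of nonnegative elements of `M`. -/
def posCone : Set (LpVec d p P) := (M : Set (LpVec d p P)) ∩ nonneg d p P

/-- The image space `𝒢(M; M_+)`: the subsets `D` of `M` with `D = cl co (D + M_+)`. -/
def imageSpace : Set (Set (LpVec d p P)) :=
  {D | D ⊆ M ∧ D = closure[topo d p P] (convexHull ℝ (D + posCone P M))}

/-- `R` is a conditional risk measure for the space `M` of eligible portfolios. -/
structure IsCondRiskMeasure (R : LpVec d p P → Set (LpVec d p P)) : Prop where
  translative : ∀ X, ∀ u ∈ M, R (X + u) = (fun z => z - u) '' R X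
  monotone : ∀ X Y, Y - X ∈ nonneg d p P → R X ⊆ R Y
  nonempty_zero : (R 0).Nonempty
  ne_zero : R 0 ≠ (M : Set (LpVec d p P))

/-- Convexity of a set-valued function. -/
def IsConvexMap (R : LpVec d p P → Set (LpVec d p P)) : Prop :=
  ∀ X Y, ∀ l ∈ Set.Icc (0 : ℝ) 1, l • R X + (1 - l) • R Y ⊆ R (l • X + (1 - l) • Y)

/-- Closedness of a set-valued function with values in subsets of `M`: its graph is closed. -/
def IsClosedMap (R : LpVec d p P → Set (LpVec d p P)) : Prop :=
  IsClosed[@instTopologicalSpaceProd _ _ (topo d p P) (topo d p P)]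
    {z : LpVec d p P × LpVec d p P | z.2 ∈ M ∧ z.2 ∈ R z.1}

/-- Closed convex conditional risk measures. -/
def IsClosedConvexRiskMeasure (R : LpVec d p P → Set (LpVec d p P)) : Prop :=
  IsCondRiskMeasure P M R ∧ IsConvexMap P R ∧ IsClosedMap P M R

/-- The acceptance set `A_R = {X : 0 ∈ R X}`. -/
def acceptanceSet (R : LpVec d p P → Set (LpVec d p P)) : Set (LpVec d p P) :=
  {X | 0 ∈ R X}

/-- The annihilator `M^⊥ ⊆ L^q_d(m)`. -/
def annihilator (q : ℝ≥0∞) : Set (LpVec d q P) :=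
  {v | v ∈ LpSub m d q P ∧ ∀ u ∈ M, pairing P v u = 0}

/-- The positive dual cone `(M_+)^+ ⊆ L^q_d(m)`. -/
def dualCone (q : ℝ≥0∞) : Set (LpVec d q P) :=
  {v | v ∈ LpSub m d q P ∧ ∀ u ∈ posCone P M, 0 ≤ pairing P v u}

/-- The half space `G(w) = {x ∈ L^p_d(m) : 0 ≤ E[wᵀ x]}`. -/
def halfSpace (p : ℝ≥0∞) (w : LpVec d q P) : Set (LpVec d p P) :=
  {x | x ∈ LpSub m d p P ∧ 0 ≤ pairing P w x}

/-- Vector probability measures with components absolutely continuous with respect to `P`. -/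
def IsVectorProb (Q : Fin d → Measure Ω) : Prop :=
  ∀ i, IsProbabilityMeasure (Q i) ∧ Q i ≪ P

/-- The density `dQ_i/dP`. -/
def density (Q : Fin d → Measure Ω) (i : Fin d) (ω : Ω) : ℝ :=
  ((Q i).rnDeriv P ω).toReal

open Classical in
/-- The vector `diag(E[dQ/dP | m])⁻¹ dQ/dP`. A component is `1` where `E[dQ_i/dP | m] = 0`: this is
the value (almost surely) of the product of the one-step transition densities after time `t`, each
of which is `1` where its denominator vanishes. -/
def condDensity (Q : Fin d → Measure Ω) (i : Fin d) (ω : Ω) : ℝ :=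
  if 0 < condExp m P (density P Q i) ω then density P Q i ω / condExp m P (density P Q i) ω else 1

/-- The random vector `diag(w) diag(E[dQ/dP | m])⁻¹ dQ/dP`. -/
def couplingVec (Q : Fin d → Measure Ω) (w : LpVec d q P) (ω : Ω) : Vec d :=
  WithLp.toLp 2 fun i => w ω i * condDensity m P Q i ω

/-- The `Q`-conditional expectation
`E^Q[X | m] = diag(E[dQ/dP | m])⁻¹ E[diag(dQ/dP) X | m]`, defined `P`-almost surely. In each
component it is the (generalized) conditional expectation `E[Z⁺ | m] - E[Z⁻ | m]` of
`Z = condDensity * X_i`, with a summand that is infinite replaced by `0`. It need not lie in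
`L^p_d`; for dual variables `(Q, w)` as below, infinite values occur in the `i`-th component only
where `w_i = 0`. -/
def condExpQ (Q : Fin d → Measure Ω) (X : Ω → Vec d) (ω : Ω) : Vec d :=
  WithLp.toLp 2 fun i =>
    (condLExp m P (fun ω' => ENNReal.ofReal (condDensity m P Q i ω' * X ω' i)) ω).toReal
      - (condLExp m P (fun ω' => ENNReal.ofReal (-(condDensity m P Q i ω' * X ω' i))) ω).toReal

/-- The set `(E^Q[X | m] + G(w)) ∩ M`, that is `{u ∈ M : E[wᵀ E^Q[X | m]] ≤ E[wᵀ u]}`. -/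
def shiftedHalfSpace (Q : Fin d → Measure Ω) (w : LpVec d q P) (X : LpVec d p P) :
    Set (LpVec d p P) :=
  {u | u ∈ M ∧ pairing P w (condExpQ m P Q X) ≤ pairing P w u}

/-- The set `𝒲^q` of dual variables `(Q, w)`. -/
def dualVars (q : ℝ≥0∞) : Set ((Fin d → Measure Ω) × LpVec d q P) :=
  {x | IsVectorProb P x.1 ∧ x.2 ∈ dualCone m P M q \ annihilator m P M q ∧
    MemLp (couplingVec m P x.1 x.2) q P ∧
    ∀ᵐ ω ∂P, ∀ i, 0 ≤ couplingVec m P x.1 x.2 ω i}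

/-- `a` (written `-α` in the literature) is a penalty function. -/
structure IsPenalty (a : dualVars m P M q → Set (LpVec d p P)) : Prop where
  mem_imageSpace : ∀ x, a x ∈ imageSpace P M
  nonempty_inter : (⋂ x, a x).Nonempty
  exists_ne : ∃ x, a x ≠ (M : Set (LpVec d p P))
  eq_closure : ∀ x : dualVars m P M q,
    a x = closure[topo d p P] (a x + halfSpace m P p x.1.2) ∩ (M : Set (LpVec d p P))

/-- The dual representation of `R` with the penalty function `a`. -/
def HasDualRep (R : LpVec d p P → Set (LpVec d p P))
    (a : dualVars m P M q → Set (LpVec d p P)) : Prop :=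
  ∀ X, R X = ⋂ x : dualVars m P M q, (a x + shiftedHalfSpace m P M x.1.1 x.1.2 (-X))

/-- The minimal penalty function of `R`. -/
def minPenalty (R : LpVec d p P → Set (LpVec d p P)) (x : dualVars m P M q) :
    Set (LpVec d p P) :=
  closure[topo d p P] (⋃ Z ∈ acceptanceSet P R, shiftedHalfSpace m P M x.1.1 x.1.2 Z)

end

end

end SetRisk

/-! By translativity, `u ∈ R X` holds exactly when `X + u` lies in the acceptance set `A = {X | 0 ∈
R X}`, so the theorem is a description of the closed convex set `A` by half spaces. Hahn–Banach
separates a point outside `A` from `A` by a continuous functional. Since `A` is stable under adding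
nonnegative vectors, this functional is nonnegative on them. It may vanish on `M`, but `R 0 ≠ M`
supplies a second separating functional that does not, and adding a small multiple of it repairs the
first (`exists_separating_ne`).

On the side of the penalties, `a x` is closed and upward closed along a functional `c x` that is
nonzero on `M`. Hence it is either `M` or a half space `{s ≤ c x}` of `M` (`eq_or_eq_halfSpace`).
Each set in the intersection is then explicit, namely `M` or `{u ∈ M | s ≤ c x (X + u)}`, and the
axioms of a risk measure can be read off. The minimal penalty records the infimum of `c x` over `A`.

The link with probability is that the pairs `(Q, w)` parametrize precisely the positive continuous
functionals that do not vanish on `M`. The pair acts by `X ↦ E[(diag(w) ξ^Q)ᵀ X]`, which equals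
`E[wᵀ E^Q[X | m]]` and reduces to `E[wᵀ u]` for `m`-measurable `u` (`pairing_condExpQ`,
`pairing_couplingVec`). Conversely, a positive functional is the pairing with some `v ≥ 0` in `L^q`
(`exists_pairing_of_positive`), and `v = diag(w) ξ^Q` for `w = E[v | m]` and `dQ_i/dP` proportional
to `v_i` (`exists_dualVars_couplingVec`). -/

namespace SetRisk

/-! ### Duality for set-valued maps in a locally convex space -/

section Abstract

variable {E : Type*} [AddCommGroup E] [Module ℝ E] [TopologicalSpace E]

/-- The half space `{u ∈ M : c X ≤ c u}` of `M`. -/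
def subHalfSpace (M : Submodule ℝ E) (c : E →L[ℝ] ℝ) (X : E) : Set E :=
  {u | u ∈ M ∧ c X ≤ c u}

/-- The half space `{y ∈ L : 0 ≤ c y}` of `L`. -/
def coneHalfSpace (L : Submodule ℝ E) (c : E →L[ℝ] ℝ) : Set E :=
  {y | y ∈ L ∧ 0 ≤ c y}

/-- The subsets `D` of `M` with `D = cl co (D + M ∩ K)`. -/
def closedUpperSets (M : Submodule ℝ E) (K : Set E) : Set (Set E) :=
  {D | D ⊆ M ∧ D = closure (convexHull ℝ (D + (M : Set E) ∩ K))}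

/-- Closed convex translative monotone set-valued functions that are finite at zero. -/
structure IsClosedConvexTranslative (M : Submodule ℝ E) (K : Set E) (R : E → Set E) : Prop where
  translative : ∀ X, ∀ u ∈ M, R (X + u) = (fun z => z - u) '' R X
  monotone : ∀ X Y, Y - X ∈ K → R X ⊆ R Y
  nonempty_zero : (R 0).Nonempty
  ne_zero : R 0 ≠ (M : Set E)
  convex : ∀ X Y, ∀ l ∈ Set.Icc (0 : ℝ) 1, l • R X + (1 - l) • R Y ⊆ R (l • X + (1 - l) • Y)
  closed : IsClosed {z : E × E | z.2 ∈ M ∧ z.2 ∈ R z.1}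

/-- Penalty functions for a family `c` of dual variables. -/
structure IsAbstractPenalty {ι : Type*} (M L : Submodule ℝ E) (K : Set E) (c : ι → E →L[ℝ] ℝ)
    (a : ι → Set E) : Prop where
  mem : ∀ x, a x ∈ closedUpperSets M K
  nonempty_inter : (⋂ x, a x).Nonempty
  exists_ne : ∃ x, a x ≠ (M : Set E)
  eq_closure : ∀ x, a x = closure (a x + coneHalfSpace L (c x)) ∩ (M : Set E)

/-- The minimal penalty function of `R`. -/
def abstractMinPenalty (M : Submodule ℝ E) (R : E → Set E) (c : E →L[ℝ] ℝ) : Set E :=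
  closure (⋃ Z ∈ {X | 0 ∈ R X}, subHalfSpace M c Z)

variable {M L : Submodule ℝ E} {K : Set E}

lemma exists_mem_apply_eq {c : E →L[ℝ] ℝ} (hc : ∃ u ∈ M, c u ≠ 0) (r : ℝ) :
    ∃ u ∈ M, c u = r := by
  obtain ⟨u, hu, hne⟩ := hc
  exact ⟨(r / c u) • u, M.smul_mem _ hu, by simp [hne]⟩

/-- As `c` maps `M` onto `ℝ`, any `u` splits off a `v ∈ M` with `c v = c X` exactly, so the two
bounds add with no loss. -/
lemma add_subHalfSpace {c : E →L[ℝ] ℝ} (hc : ∃ u ∈ M, c u ≠ 0) (s : ℝ) (X : E) :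
    {u | u ∈ M ∧ s ≤ c u} + subHalfSpace M c X = {u | u ∈ M ∧ s + c X ≤ c u} := by
  ext u
  simp only [Set.mem_add, Set.mem_ofPred_eq, subHalfSpace]
  constructor
  · rintro ⟨b, ⟨hb, hsb⟩, v, ⟨hv, hXv⟩, rfl⟩
    exact ⟨M.add_mem hb hv, by rw [map_add]; linarith⟩
  · rintro ⟨hu, h⟩
    obtain ⟨v, hv, hvX⟩ := exists_mem_apply_eq hc (c X)
    exact ⟨u - v, ⟨M.sub_mem hu hv, by rw [map_sub]; linarith⟩, v, ⟨hv, hvX.ge⟩, by abel⟩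

lemma coe_add_subHalfSpace {c : E →L[ℝ] ℝ} (hc : ∃ u ∈ M, c u ≠ 0) (X : E) :
    (M : Set E) + subHalfSpace M c X = M := by
  ext u
  constructor
  · rintro ⟨b, hb, v, hv, rfl⟩
    exact M.add_mem hb hv.1
  · intro hu
    obtain ⟨v, hv, hvX⟩ := exists_mem_apply_eq hc (c X)
    exact ⟨u - v, M.sub_mem hu hv, v, ⟨hv, hvX.ge⟩, by simp⟩

/-- The difference `u - b` belongs to the cone half space, so the fixed-point equation for `D` makes
`D` upward closed along `c`. -/
lemma mem_of_apply_le {c : E →L[ℝ] ℝ} (hML : M ≤ L) {D : Set E} (hDM : D ⊆ M)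
    (hD : D = closure (D + coneHalfSpace L c) ∩ (M : Set E)) {b u : E} (hb : b ∈ D) (hu : u ∈ M)
    (h : c b ≤ c u) : u ∈ D := by
  rw [hD]
  refine ⟨subset_closure ⟨b, hb, u - b, ⟨hML (M.sub_mem hu (hDM hb)), ?_⟩, by simp⟩, hu⟩
  rw [map_sub]; linarith

lemma closedUpperSets_isClosed {D : Set E} (hD : D ∈ closedUpperSets M K) : IsClosed D := by
  rw [hD.2]; exact isClosed_closure

lemma mem_closedUpperSets {c : E →L[ℝ] ℝ} (hM : IsClosed (M : Set E)) (hK0 : (0 : E) ∈ K)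
    (hcK : ∀ k ∈ K, 0 ≤ c k) {D : Set E} (hD : D = M ∨ ∃ s, D = {u | u ∈ M ∧ s ≤ c u}) :
    D ∈ closedUpperSets M K := by
  have hDM : D ⊆ M := by
    rcases hD with rfl | ⟨s, rfl⟩
    · exact subset_rfl
    · exact fun u hu => hu.1
  have hcl : IsClosed D := by
    rcases hD with rfl | ⟨s, rfl⟩
    · exact hM
    · exact hM.inter (isClosed_le continuous_const c.continuous)
  have hcv : Convex ℝ D := by
    rcases hD with rfl | ⟨s, rfl⟩
    · exact M.convex
    · exact M.convex.inter (convex_halfSpace_ge c.toLinearMap.isLinear s)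
  have hadd : D + (M : Set E) ∩ K = D := by
    apply Set.Subset.antisymm
    · rintro _ ⟨b, hb, k, hk, rfl⟩
      rcases hD with rfl | ⟨s, rfl⟩
      · exact M.add_mem hb hk.1
      · exact ⟨M.add_mem hb.1 hk.1, by have := hcK k hk.2; have := hb.2; rw [map_add]; linarith⟩
    · exact fun b hb => ⟨b, hb, 0, ⟨M.zero_mem, hK0⟩, by simp⟩
  exact ⟨hDM, by rw [hadd, hcv.convexHull_eq, hcl.closure_eq]⟩

lemma eq_closure_add_coneHalfSpace {c : E →L[ℝ] ℝ}
    {D : Set E} (hD : D = M ∨ ∃ s, D = {u | u ∈ M ∧ s ≤ c u}) :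
    D = closure (D + coneHalfSpace L c) ∩ (M : Set E) := by
  apply Set.Subset.antisymm
  · have hDM : D ⊆ M := by
      rcases hD with rfl | ⟨s, rfl⟩
      · exact subset_rfl
      · exact fun u hu => hu.1
    exact fun u hu => ⟨subset_closure ⟨u, hu, 0, ⟨L.zero_mem, by simp⟩, by simp⟩, hDM hu⟩
  · rintro u ⟨hu, huM⟩
    rcases hD with rfl | ⟨s, rfl⟩
    · exact huM
    · refine ⟨huM, ?_⟩
      have hcl : IsClosed {u : E | s ≤ c u} := isClosed_le continuous_const c.continuous
      refine closure_minimal ?_ hcl hu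
      rintro _ ⟨b, hb, k, hk, rfl⟩
      have := hb.2
      have := hk.2
      simp only [Set.mem_ofPred_eq, map_add]
      linarith

lemma mem_abstractMinPenalty {R : E → Set E} {v : E →L[ℝ] ℝ} {Z u : E} (hZ : 0 ∈ R Z) (hu : u ∈ M)
    (hZu : v Z ≤ v u) : u ∈ abstractMinPenalty M R v := by
  refine subset_closure ?_
  simp only [Set.mem_iUnion]
  exact ⟨Z, hZ, hu, hZu⟩

lemma le_of_mem_abstractMinPenalty {R : E → Set E} {v : E →L[ℝ] ℝ} {r : ℝ} (hr : ∀ Z, 0 ∈ R Z → r ≤ v Z) {u : E}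
    (hu : u ∈ abstractMinPenalty M R v) : r ≤ v u := by
  have hcl : IsClosed {u : E | r ≤ v u} := isClosed_le continuous_const v.continuous
  refine closure_minimal ?_ hcl hu
  simp only [Set.iUnion_subset_iff]
  exact fun Z hZ u hu => (hr Z hZ).trans hu.2

variable {ι : Type*} {c : ι → E →L[ℝ] ℝ}

/-- Every penalty function that represents `R` contains the minimal one. -/
theorem abstractMinPenalty_subset {a : ι → Set E} (ha : IsAbstractPenalty M L K c a)
    (hML : M ≤ L) {R : E → Set E} (hR : ∀ X, R X = ⋂ x, (a x + subHalfSpace M (c x) (-X)))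
    (x : ι) : abstractMinPenalty M R (c x) ⊆ a x := by
  refine closure_minimal ?_ (closedUpperSets_isClosed (ha.mem x))
  simp only [Set.iUnion_subset_iff]
  rintro Z hZ u ⟨hu, hZu⟩
  rw [Set.mem_ofPred_eq, hR, Set.mem_iInter] at hZ
  obtain ⟨b, hb, v, hv, hbv⟩ := hZ x
  refine mem_of_apply_le hML (ha.mem x).1 (ha.eq_closure x) hb hu ?_
  have h1 := hv.2
  have h2 : c x b + c x v = 0 := by rw [← map_add]; simp only at hbv; rw [hbv, map_zero]
  rw [map_neg] at h1
  linarith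

namespace IsClosedConvexTranslative

variable {R : E → Set E} (h : IsClosedConvexTranslative M K R)

include h

/-- This turns every statement about values of `R` into one about its acceptance set. -/
lemma zero_mem_iff {X u : E} (hu : u ∈ M) : 0 ∈ R (X + u) ↔ u ∈ R X := by
  rw [h.translative X u hu]
  constructor
  · rintro ⟨z, hz, hzu⟩
    rwa [← sub_eq_zero.1 hzu]
  · exact fun hz => ⟨u, hz, by simp⟩

lemma isClosed_acceptance : IsClosed {X | (0 : E) ∈ R X} := by
  have : {X | (0 : E) ∈ R X} = (fun X => (X, (0 : E))) ⁻¹' {z : E × E | z.2 ∈ M ∧ z.2 ∈ R z.1} := by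
    ext X; simp
  rw [this]
  exact h.closed.preimage (by fun_prop)

lemma convex_acceptance : Convex ℝ {X | (0 : E) ∈ R X} := by
  intro X hX Y hY a b ha hb hab
  obtain rfl : b = 1 - a := by linarith
  refine h.convex X Y a ⟨ha, by linarith⟩ ⟨0, ⟨0, hX, by simp⟩, 0, ⟨0, hY, by simp⟩, by simp⟩

end IsClosedConvexTranslative

variable [IsTopologicalAddGroup E] [ContinuousSMul ℝ E]

/-- The threshold is the infimum of `c` on `D`. If `c` is unbounded below on `D`, upward closedness
already gives all of `M`. -/
lemma eq_or_eq_halfSpace {c : E →L[ℝ] ℝ} (hc : ∃ u ∈ M, c u ≠ 0) {D : Set E} (hDM : D ⊆ M)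
    (hcl : IsClosed D) (hne : D.Nonempty)
    (hup : ∀ b ∈ D, ∀ u ∈ M, c b ≤ c u → u ∈ D) :
    D = M ∨ ∃ s, D = {u | u ∈ M ∧ s ≤ c u} := by
  by_cases hb : BddBelow (c '' D)
  · refine Or.inr ⟨sInf (c '' D), Set.Subset.antisymm
      (fun u hu => ⟨hDM hu, csInf_le hb ⟨u, hu, rfl⟩⟩) ?_⟩
    rintro u ⟨hu, hs⟩
    -- The infimum need not be attained: a boundary point is pushed inside by `e • m`, and `e → 0`
    -- uses that `D` is closed.
    obtain ⟨m, hm, hm1⟩ := exists_mem_apply_eq hc 1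
    have key : ∀ e : ℝ, 0 < e → u + e • m ∈ D := fun e he => by
      obtain ⟨_, ⟨b, hbD, rfl⟩, hlt⟩ := exists_lt_of_csInf_lt (hne.image c)
        (show sInf (c '' D) < c u + e by linarith)
      exact hup b hbD _ (M.add_mem hu (M.smul_mem _ hm)) (by simp [hm1]; linarith)
    have hlim : Filter.Tendsto (fun e : ℝ => u + e • m) (𝓝[>] 0) (𝓝 (u + (0 : ℝ) • m)) :=
      Filter.Tendsto.mono_left (Continuous.tendsto (by fun_prop) 0) nhdsWithin_le_nhds
    simp only [zero_smul, add_zero] at hlim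
    exact hcl.mem_of_tendsto hlim (Filter.eventually_of_mem self_mem_nhdsWithin key)
  · refine Or.inl (Set.Subset.antisymm hDM fun u hu => ?_)
    obtain ⟨_, ⟨b, hbD, rfl⟩, hlt⟩ := not_bddBelow_iff.1 hb (c u)
    exact hup b hbD u hu hlt.le

lemma IsAbstractPenalty.eq_or_eq_halfSpace {a : ι → Set E} (ha : IsAbstractPenalty M L K c a)
    (hML : M ≤ L) (hcM : ∀ x, ∃ u ∈ M, c x u ≠ 0) (x : ι) :
    a x = M ∨ ∃ s, a x = {u | u ∈ M ∧ s ≤ c x u} :=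
  SetRisk.eq_or_eq_halfSpace (hcM x) (ha.mem x).1 (closedUpperSets_isClosed (ha.mem x))
    (ha.nonempty_inter.mono (Set.iInter_subset _ x))
    (fun _ hb _ hu h => mem_of_apply_le hML (ha.mem x).1 (ha.eq_closure x) hb hu h)

/-- Penalty functions define closed convex risk measures. -/
theorem IsAbstractPenalty.isClosedConvexTranslative {a : ι → Set E}
    (ha : IsAbstractPenalty M L K c a) (hM : IsClosed (M : Set E)) (hML : M ≤ L)
    (hcK : ∀ x, ∀ k ∈ K, 0 ≤ c x k) (hcM : ∀ x, ∃ u ∈ M, c x u ≠ 0) {R : E → Set E}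
    (hR : ∀ X, R X = ⋂ x, (a x + subHalfSpace M (c x) (-X))) :
    IsClosedConvexTranslative M K R := by
  -- Every member of the intersection is `M` for all `X`, or a half space with a threshold `s` that
  -- does not depend on `X`. All required properties are checked on these two shapes.
  have hform : ∀ x, (∀ X, a x + subHalfSpace M (c x) (-X) = M) ∨
      ∃ s, ∀ X, a x + subHalfSpace M (c x) (-X) = {u | u ∈ M ∧ s ≤ c x (X + u)} := fun x => by
    rcases ha.eq_or_eq_halfSpace hML hcM x with h | ⟨s, h⟩
    · exact Or.inl fun X => by rw [h, coe_add_subHalfSpace (hcM x)]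
    · refine Or.inr ⟨s, fun X => ?_⟩
      rw [h, add_subHalfSpace (hcM x)]
      ext u
      simp only [Set.mem_ofPred_eq, map_neg, map_add]
      constructor <;> rintro ⟨h1, h2⟩ <;> exact ⟨h1, by linarith⟩
  have hmem : ∀ X u, u ∈ R X ↔ ∀ x, u ∈ a x + subHalfSpace M (c x) (-X) := fun X u => by
    rw [hR, Set.mem_iInter]
  obtain ⟨x₀, hx₀⟩ := ha.exists_ne
  have hRM : ∀ X, R X ⊆ M := fun X u hu => by
    have := (hmem X u).1 hu x₀
    rcases hform x₀ with h | ⟨s, h⟩ <;> rw [h] at this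
    · exact this
    · exact this.1
  refine ⟨fun X u hu => ?_, fun X Y hXY z hz => ?_, ?_, ?_, ?_, ?_⟩
  · ext z
    have : z ∈ (fun z => z - u) '' R X ↔ z + u ∈ R X :=
      ⟨by rintro ⟨y, hy, rfl⟩; simpa using hy, fun h => ⟨z + u, h, by simp⟩⟩
    rw [this, hmem, hmem]
    refine forall_congr' fun x => ?_
    have hzM : z + u ∈ M ↔ z ∈ M := M.add_mem_iff_left hu
    rcases hform x with h | ⟨s, h⟩ <;> rw [h, h]
    · exact hzM.symm
    · simp only [Set.mem_ofPred_eq, hzM, add_assoc, add_comm u z]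
  · rw [hmem] at hz ⊢
    intro x
    have := hz x
    rcases hform x with h | ⟨s, h⟩ <;> rw [h] at this ⊢
    · exact this
    · refine ⟨this.1, this.2.trans ?_⟩
      have := hcK x _ hXY
      simp only [map_sub, map_add] at *
      linarith
  · obtain ⟨u, hu⟩ := ha.nonempty_inter
    refine ⟨u, (hmem _ _).2 fun x => ?_⟩
    exact ⟨u, Set.mem_iInter.1 hu x, 0, ⟨M.zero_mem, by simp⟩, by simp⟩
  -- At `X = 0` the second summand only moves upward along `c x₀`, so it keeps points inside `a x₀`;
  -- thus `R 0 = M` would force `a x₀ = M`.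
  · intro h0
    apply hx₀
    refine Set.Subset.antisymm (ha.mem x₀).1 fun u hu => ?_
    rw [← h0] at hu
    obtain ⟨b, hb, v, hv, rfl⟩ := (hmem _ _).1 hu x₀
    refine mem_of_apply_le hML (ha.mem x₀).1 (ha.eq_closure x₀) hb
      (M.add_mem ((ha.mem x₀).1 hb) hv.1) ?_
    have := hv.2
    simp only [neg_zero, map_zero] at this
    simpa using this
  · rintro X Y l ⟨hl0, hl1⟩ _ ⟨_, ⟨u, hu, rfl⟩, _, ⟨v, hv, rfl⟩, rfl⟩
    simp only
    rw [hmem] at hu hv ⊢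
    intro x
    have hux := hu x
    have hvx := hv x
    rcases hform x with h | ⟨s, h⟩ <;> rw [h] at hux hvx ⊢
    · exact M.add_mem (M.smul_mem _ hux) (M.smul_mem _ hvx)
    · refine ⟨M.add_mem (M.smul_mem _ hux.1) (M.smul_mem _ hvx.1), ?_⟩
      have h1 := mul_le_mul_of_nonneg_left hux.2 hl0
      have h2 := mul_le_mul_of_nonneg_left hvx.2 (sub_nonneg.2 hl1)
      simp only [map_add, map_smul, smul_eq_mul] at *
      linarith
  · have hset : {z : E × E | z.2 ∈ M ∧ z.2 ∈ R z.1} =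
        {z : E × E | z.2 ∈ M} ∩ ⋂ x, {z : E × E | z.2 ∈ a x + subHalfSpace M (c x) (-z.1)} := by
      ext z; simp [hmem]
    have hMz : IsClosed {z : E × E | z.2 ∈ M} := hM.preimage continuous_snd
    rw [hset]
    refine hMz.inter (isClosed_iInter fun x => ?_)
    rcases hform x with h | ⟨s, h⟩ <;> simp only [h]
    · exact hMz
    · exact hMz.inter (isClosed_le continuous_const
        ((c x).continuous.comp (continuous_fst.add continuous_snd)))

namespace IsClosedConvexTranslative

variable {R : E → Set E} (h : IsClosedConvexTranslative M K R)

include h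

/-- Translation by an element of `M` on which `v` is nonnegative maps the union of half spaces into
itself, hence also its closure. So the closure is upward closed along `v`. -/
lemma abstractMinPenalty_eq (hM : IsClosed (M : Set E)) (hRM : ∀ X, R X ⊆ M) {v : E →L[ℝ] ℝ}
    (hv : ∃ u ∈ M, v u ≠ 0) :
    abstractMinPenalty M R v = M ∨ ∃ s, abstractMinPenalty M R v = {u | u ∈ M ∧ s ≤ v u} := by
  have hU : (⋃ Z ∈ {X | (0 : E) ∈ R X}, subHalfSpace M v Z) ⊆ M := by
    simp only [Set.iUnion_subset_iff]
    exact fun Z _ u hu => hu.1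
  have hDM : abstractMinPenalty M R v ⊆ M := closure_minimal hU hM
  refine eq_or_eq_halfSpace hv hDM isClosed_closure ?_ ?_
  · obtain ⟨u, hu⟩ := h.nonempty_zero
    refine ⟨u, subset_closure ?_⟩
    simp only [Set.mem_iUnion]
    exact ⟨0 + u, (h.zero_mem_iff (hRM 0 hu)).2 hu, hRM 0 hu, by simp⟩
  · intro b hb u hu hbu
    have hmaps : Set.MapsTo (fun z => z + (u - b)) (⋃ Z ∈ {X | (0 : E) ∈ R X}, subHalfSpace M v Z)
        (⋃ Z ∈ {X | (0 : E) ∈ R X}, subHalfSpace M v Z) := by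
      intro z hz
      simp only [Set.mem_iUnion] at hz ⊢
      obtain ⟨Z, hZ, hz⟩ := hz
      refine ⟨Z, hZ, M.add_mem hz.1 (M.sub_mem hu (hDM hb)), ?_⟩
      have := hz.2
      simp only [map_add, map_sub]
      linarith
    have := hmaps.closure (by fun_prop) hb
    rw [show u = b + (u - b) by abel]
    exact this

variable [LocallyConvexSpace ℝ E]

lemma exists_separating (hK : ∀ k ∈ K, ∀ r : ℝ, 0 ≤ r → r • k ∈ K) (hRM : ∀ X, R X ⊆ M)
    {Y : E} (hY : 0 ∉ R Y) :
    ∃ (v : E →L[ℝ] ℝ) (r : ℝ), (∀ k ∈ K, 0 ≤ v k) ∧ v Y < r ∧ ∀ Z, 0 ∈ R Z → r ≤ v Z := by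
  obtain ⟨v, r, h1, h2⟩ := geometric_hahn_banach_point_closed h.convex_acceptance
    h.isClosed_acceptance (x := Y) hY
  refine ⟨v, r, fun k hk => ?_, h1, fun Z hZ => (h2 Z hZ).le⟩
  by_contra! hneg
  obtain ⟨u, hu⟩ := h.nonempty_zero
  have hu0 := (h.zero_mem_iff (hRM 0 hu)).2 hu
  -- The multiple of `k` is chosen so that `v` takes the value `r` at an accepted point, where it
  -- must exceed `r` strictly.
  have hlt := h2 _ (h.monotone (0 + u) (0 + u + ((v (0 + u) - r) / -v k) • k)
    (by
      rw [add_sub_cancel_left]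
      exact hK k hk _ (div_nonneg (sub_nonneg.2 (h2 _ hu0).le) (by linarith))) hu0)
  rw [map_add, map_smul, smul_eq_mul, div_mul_eq_mul_div, mul_div_assoc, div_neg,
    div_self hneg.ne] at hlt
  linarith

/-- A separating functional that vanishes on `M` is perturbed by `e • v₀`, where `v₀` separates a
point of `M` outside `R 0`. The functional `v₀` takes different values at two points of `M`, so it
is nonzero there. -/
lemma exists_separating_ne (hK : ∀ k ∈ K, ∀ r : ℝ, 0 ≤ r → r • k ∈ K) (hRM : ∀ X, R X ⊆ M)
    {Y : E} (hY : 0 ∉ R Y) :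
    ∃ (v : E →L[ℝ] ℝ) (r : ℝ), (∀ k ∈ K, 0 ≤ v k) ∧ (∃ u ∈ M, v u ≠ 0) ∧ v Y < r ∧
      ∀ Z, 0 ∈ R Z → r ≤ v Z := by
  obtain ⟨v, r, hvK, hvY, hvA⟩ := h.exists_separating hK hRM hY
  by_cases hv : ∃ u ∈ M, v u ≠ 0
  · exact ⟨v, r, hvK, hv, hvY, hvA⟩
  push Not at hv
  obtain ⟨u₀, hu₀M, hu₀⟩ : ∃ u ∈ M, u ∉ R 0 := by
    by_contra! hall
    exact h.ne_zero (Set.Subset.antisymm (hRM 0) hall)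
  obtain ⟨v₀, r₀, hK₀, hY₀, hA₀⟩ :=
    h.exists_separating hK hRM (Y := 0 + u₀) (by rwa [h.zero_mem_iff hu₀M])
  obtain ⟨u₁, hu₁⟩ := h.nonempty_zero
  have hu₁M := hRM 0 hu₁
  have hlt : v₀ (0 + u₀) < v₀ (0 + u₁) :=
    hY₀.trans_le (hA₀ _ ((h.zero_mem_iff hu₁M).2 hu₁))
  have hne : ∃ u ∈ M, v₀ u ≠ 0 := by
    by_contra! h0
    simp [h0 u₀ hu₀M, h0 u₁ hu₁M] at hlt
  -- The gap `r - v Y` must absorb `e * (v₀ Y - r₀)`; dividing by the absolute value plus one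
  -- achieves this and avoids a zero denominator.
  obtain ⟨e, he, hlt'⟩ : ∃ e : ℝ, 0 < e ∧ v Y + e * v₀ Y < r + e * r₀ := by
    have hpos : 0 < |v₀ Y - r₀| + 1 := by positivity
    refine ⟨(r - v Y) / (|v₀ Y - r₀| + 1), div_pos (sub_pos.2 hvY) hpos, ?_⟩
    have h1 : (r - v Y) / (|v₀ Y - r₀| + 1) * (v₀ Y - r₀) < r - v Y := by
      rw [div_mul_eq_mul_div, div_lt_iff₀ hpos]
      exact mul_lt_mul_of_pos_left (by linarith [le_abs_self (v₀ Y - r₀)]) (sub_pos.2 hvY)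
    rw [mul_sub] at h1
    linarith
  refine ⟨v + e • v₀, r + e * r₀, fun k hk => ?_, ?_, ?_, fun Z hZ => ?_⟩
  · have := mul_nonneg he.le (hK₀ k hk)
    have := hvK k hk
    simp
    linarith
  · obtain ⟨u, hu, hne⟩ := hne
    exact ⟨u, hu, by simp [hv u hu, hne, he.ne']⟩
  · simpa using hlt'
  · have := mul_le_mul_of_nonneg_left (hA₀ Z hZ) he.le
    have := hvA Z hZ
    simp
    linarith

variable (hK : ∀ k ∈ K, ∀ r : ℝ, 0 ≤ r → r • k ∈ K) (hRM : ∀ X, R X ⊆ M)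
  (hM : IsClosed (M : Set E)) (hcM : ∀ x, ∃ u ∈ M, c x u ≠ 0)
  (hsurj : ∀ v : E →L[ℝ] ℝ, (∀ k ∈ K, 0 ≤ v k) → (∃ u ∈ M, v u ≠ 0) → ∃ x, c x = v)

include hK hRM hM hcM hsurj

/-- The minimal penalty function is a penalty function. -/
theorem isAbstractPenalty_min (hK0 : (0 : E) ∈ K) (hcK : ∀ x, ∀ k ∈ K, 0 ≤ c x k) :
    IsAbstractPenalty M L K c (fun x => abstractMinPenalty M R (c x)) := by
  refine ⟨fun x => mem_closedUpperSets hM hK0 (hcK x) (h.abstractMinPenalty_eq hM hRM (hcM x)),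
    ?_, ?_, fun x => eq_closure_add_coneHalfSpace (h.abstractMinPenalty_eq hM hRM (hcM x))⟩
  · obtain ⟨u, hu⟩ := h.nonempty_zero
    exact ⟨u, Set.mem_iInter.2 fun x => mem_abstractMinPenalty
      ((h.zero_mem_iff (hRM 0 hu)).2 hu) (hRM 0 hu) (by simp)⟩
  · obtain ⟨u₀, hu₀M, hu₀⟩ : ∃ u ∈ M, u ∉ R 0 := by
      by_contra! hall
      exact h.ne_zero (Set.Subset.antisymm (hRM 0) hall)
    obtain ⟨v, r, hvK, hvM, hvY, hvA⟩ :=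
      h.exists_separating_ne hK hRM (Y := 0 + u₀) (by rwa [h.zero_mem_iff hu₀M])
    obtain ⟨x, rfl⟩ := hsurj v hvK hvM
    refine ⟨x, fun heq => ?_⟩
    have hu₀' : u₀ ∈ abstractMinPenalty M R (c x) := by rw [heq]; exact hu₀M
    have := le_of_mem_abstractMinPenalty hvA hu₀'
    rw [zero_add] at hvY
    linarith

/-- The dual representation with the minimal penalty function. -/
theorem eq_iInter_abstractMinPenalty (X : E) :
    R X = ⋂ x, (abstractMinPenalty M R (c x) + subHalfSpace M (c x) (-X)) := by
  ext u
  rw [Set.mem_iInter]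
  constructor
  · intro hu x
    have hXu := (h.zero_mem_iff (hRM X hu)).2 hu
    -- The accepted vector `X + u` puts `b` into the minimal penalty, and `c x (u - b) = -c x X`
    -- puts the remainder on the boundary of the other summand.
    obtain ⟨b, hb, hbu⟩ := exists_mem_apply_eq (hcM x) (c x (X + u))
    refine ⟨b, mem_abstractMinPenalty hXu hb hbu.ge, u - b,
      ⟨M.sub_mem (hRM X hu) hb, ?_⟩, by simp⟩
    rw [map_sub, hbu, map_add, map_neg]
    linarith
  · intro hu
    have hDM : ∀ x, abstractMinPenalty M R (c x) ⊆ M := fun x => by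
      rcases h.abstractMinPenalty_eq hM hRM (hcM x) with h' | ⟨s, h'⟩ <;> rw [h']
      exact fun u hu => hu.1
    have sep : ∀ Y, 0 ∉ R Y → ∃ x, ∃ r, c x Y < r ∧ ∀ Z, 0 ∈ R Z → r ≤ c x Z := fun Y hY => by
      obtain ⟨v, r, hvK, hvM, hvY, hvA⟩ := h.exists_separating_ne hK hRM hY
      obtain ⟨x, rfl⟩ := hsurj v hvK hvM
      exact ⟨x, r, hvY, hvA⟩
    obtain ⟨u₀, hu₀M, hu₀⟩ : ∃ u ∈ M, u ∉ R 0 := by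
      by_contra! hall
      exact h.ne_zero (Set.Subset.antisymm (hRM 0) hall)
    -- One index is needed to conclude `u ∈ M`: an intersection over an empty family would be the
    -- whole space.
    obtain ⟨x₀, -⟩ := sep (0 + u₀) (by rwa [h.zero_mem_iff hu₀M])
    have huM : u ∈ M := by
      obtain ⟨b, hb, v, hv, rfl⟩ := hu x₀
      exact M.add_mem (hDM _ hb) hv.1
    by_contra huR
    obtain ⟨x, r, hlt, hA⟩ := sep (X + u) (by rwa [h.zero_mem_iff huM])
    obtain ⟨b, hb, v, hv, rfl⟩ := hu x
    have h1 := le_of_mem_abstractMinPenalty hA hb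
    have h2 := hv.2
    simp only [map_add, map_neg] at hlt h2
    linarith

end IsClosedConvexTranslative

end Abstract

/-! ### Conditional densities and generalized conditional expectations -/

section Bayes

variable {Ω : Type*} {m mΩ : MeasurableSpace Ω} {P : Measure Ω}

/-- Two functions with the same integrals over `m`-measurable sets have the same integrals against
`m`-measurable functions. -/
lemma lintegral_mul_congr_of_setLIntegral (hm : m ≤ mΩ) {g g' f : Ω → ℝ≥0∞}
    (hg : AEMeasurable g P) (hg' : AEMeasurable g' P)
    (h : ∀ s, MeasurableSet[m] s → ∫⁻ ω in s, g ω ∂P = ∫⁻ ω in s, g' ω ∂P)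
    (hf : Measurable[m] f) : ∫⁻ ω, f ω * g ω ∂P = ∫⁻ ω, f ω * g' ω ∂P := by
  -- Only the restriction to `m` of the measure with density `g` matters for an `m`-measurable
  -- integrand, and the hypothesis says that these restrictions agree.
  have key : ∀ g : Ω → ℝ≥0∞, AEMeasurable g P →
      ∫⁻ ω, f ω * g ω ∂P = ∫⁻ ω, f ω ∂((P.withDensity g).trim hm) := fun g hg => by
    rw [lintegral_trim hm hf,
      lintegral_withDensity_eq_lintegral_mul₀ hg (hf.mono hm le_rfl).aemeasurable]
    exact lintegral_congr fun ω => mul_comm _ _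
  have htrim : (P.withDensity g).trim hm = (P.withDensity g').trim hm := by
    refine @Measure.ext _ m _ _ fun s hs => ?_
    rw [trim_measurableSet_eq hm hs, trim_measurableSet_eq hm hs, withDensity_apply _ (hm s hs),
      withDensity_apply _ (hm s hs), h s hs]
  rw [key g hg, key g' hg', htrim]

/-- The pull-out property of the conditional Lebesgue expectation, integrated. -/
lemma lintegral_mul_condLExp [IsFiniteMeasure P] (hm : m ≤ mΩ) {g f : Ω → ℝ≥0∞}
    (hg : AEMeasurable g P) (hf : Measurable[m] f) :
    ∫⁻ ω, f ω * condLExp m P g ω ∂P = ∫⁻ ω, f ω * g ω ∂P :=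
  lintegral_mul_congr_of_setLIntegral hm (measurable_condLExp' m P g).aemeasurable hg
    (fun _ hs => setLIntegral_condLExp hm P g hs) hf

/-- Finiteness of the weighted integral makes the product of the weight and the conditional
expectation finite almost everywhere. Infinite values therefore occur only where the weight
vanishes, and replacing them by `0` is harmless. -/
lemma integrable_mul_toReal_condLExp [IsFiniteMeasure P] (hm : m ≤ mΩ) {w : Ω → ℝ}
    {g : Ω → ℝ≥0∞} (hw : AEStronglyMeasurable[m] w P) (hw0 : 0 ≤ᵐ[P] w) (hg : AEMeasurable g P)
    (hfin : ∫⁻ ω, ENNReal.ofReal (w ω) * g ω ∂P ≠ ∞) :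
    Integrable (fun ω => w ω * (condLExp m P g ω).toReal) P ∧
      ∫ ω, w ω * (condLExp m P g ω).toReal ∂P
        = (∫⁻ ω, ENNReal.ofReal (w ω) * g ω ∂P).toReal := by
  obtain ⟨w', hw', hww'⟩ := hw
  have hmeas : Measurable[m] fun ω => ENNReal.ofReal (w' ω) :=
    ENNReal.measurable_ofReal.comp hw'.measurable
  have hL : ∫⁻ ω, ENNReal.ofReal (w' ω) * condLExp m P g ω ∂P
      = ∫⁻ ω, ENNReal.ofReal (w ω) * g ω ∂P := by
    rw [lintegral_mul_condLExp hm hg hmeas]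
    refine lintegral_congr_ae ?_
    filter_upwards [hww'] with ω h
    rw [h]
  have hprod : Measurable fun ω => ENNReal.ofReal (w' ω) * condLExp m P g ω :=
    (hmeas.mono hm le_rfl).mul (measurable_condLExp' m P g)
  have heq : (fun ω => w ω * (condLExp m P g ω).toReal) =ᵐ[P]
      fun ω => (ENNReal.ofReal (w' ω) * condLExp m P g ω).toReal := by
    filter_upwards [hww', hw0] with ω h h0
    rw [ENNReal.toReal_mul, ← h, ENNReal.toReal_ofReal h0]
  refine ⟨(integrable_toReal_of_lintegral_ne_top hprod.aemeasurable (by rwa [hL])).congr heq.symm,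
    ?_⟩
  rw [integral_congr_ae heq, integral_toReal hprod.aemeasurable
    (ae_lt_top hprod (by rwa [hL])), hL]

/-- `E[w E[Z | m]] = E[w Z]` for the generalized conditional expectation. -/
lemma integral_mul_generalizedCondExp [IsFiniteMeasure P] (hm : m ≤ mΩ) {w Z : Ω → ℝ}
    (hw : AEStronglyMeasurable[m] w P) (hw0 : 0 ≤ᵐ[P] w) (hZ : AEMeasurable Z P)
    (hwZ : Integrable (fun ω => w ω * Z ω) P) :
    Integrable (fun ω => w ω * ((condLExp m P (fun ω' => ENNReal.ofReal (Z ω')) ω).toReal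
      - (condLExp m P (fun ω' => ENNReal.ofReal (-(Z ω'))) ω).toReal)) P ∧
    ∫ ω, w ω * ((condLExp m P (fun ω' => ENNReal.ofReal (Z ω')) ω).toReal
      - (condLExp m P (fun ω' => ENNReal.ofReal (-(Z ω'))) ω).toReal) ∂P
      = ∫ ω, w ω * Z ω ∂P := by
  have hpos : ∫⁻ ω, ENNReal.ofReal (w ω) * ENNReal.ofReal (Z ω) ∂P
      = ∫⁻ ω, ENNReal.ofReal (w ω * Z ω) ∂P := by
    refine lintegral_congr_ae ?_
    filter_upwards [hw0] with ω h
    rw [ENNReal.ofReal_mul h]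
  have hneg : ∫⁻ ω, ENNReal.ofReal (w ω) * ENNReal.ofReal (-(Z ω)) ∂P
      = ∫⁻ ω, ENNReal.ofReal (-(w ω * Z ω)) ∂P := by
    refine lintegral_congr_ae ?_
    filter_upwards [hw0] with ω h
    rw [← mul_neg, ENNReal.ofReal_mul h]
  obtain ⟨hi1, he1⟩ := integrable_mul_toReal_condLExp hm hw hw0 hZ.ennreal_ofReal
    (by rw [hpos]; exact hwZ.lintegral_lt_top.ne)
  obtain ⟨hi2, he2⟩ := integrable_mul_toReal_condLExp hm hw hw0 hZ.neg.ennreal_ofReal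
    (by simp only [Pi.neg_apply]; rw [hneg]; exact hwZ.neg.lintegral_lt_top.ne)
  simp only [Pi.neg_apply] at hi2 he2
  simp only [mul_sub]
  refine ⟨hi1.sub hi2, ?_⟩
  rw [integral_sub hi1 hi2, he1, he2, integral_eq_lintegral_pos_part_sub_lintegral_neg_part hwZ,
    hpos, hneg]

variable {d : ℕ} {p q : ℝ≥0∞} {Q : Fin d → Measure Ω}

lemma measurable_density (i : Fin d) : Measurable (density P Q i) :=
  (Measure.measurable_rnDeriv _ _).ennreal_toReal

lemma measurable_condDensity (hm : m ≤ mΩ) (i : Fin d) : Measurable (condDensity m P Q i) := by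
  have h : Measurable (condExp m P (density P Q i)) :=
    (stronglyMeasurable_condExp.mono hm).measurable
  exact Measurable.ite (measurableSet_lt measurable_const h) ((measurable_density i).div h)
    measurable_const

lemma condDensity_nonneg (i : Fin d) (ω : Ω) : 0 ≤ condDensity m P Q i ω := by
  unfold condDensity
  split_ifs with h
  · exact div_nonneg ENNReal.toReal_nonneg h.le
  · exact zero_le_one

lemma integrable_density [IsFiniteMeasure P] (hQ : IsVectorProb P Q) (i : Fin d) :
    Integrable (density P Q i) P := by
  have := (hQ i).1
  exact Measure.integrable_toReal_rnDeriv

/-- The conditional density has conditional expectation one. -/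
lemma lintegral_mul_condDensity [IsFiniteMeasure P] (hm : m ≤ mΩ) (hQ : IsVectorProb P Q)
    (i : Fin d) {f : Ω → ℝ≥0∞} (hf : Measurable[m] f) :
    ∫⁻ ω, f ω * ENNReal.ofReal (condDensity m P Q i ω) ∂P = ∫⁻ ω, f ω ∂P := by
  set h := condExp m P (density P Q i) with hh
  have hhm : Measurable[m] h := stronglyMeasurable_condExp.measurable
  have hs : MeasurableSet[m] {ω | 0 < h ω} := hhm measurableSet_Ioi
  -- On `{0 < h}` the quotient by `h` is moved into the `m`-measurable factor, which reduces the
  -- claim to the defining property of `h`; off this set the conditional density is `1`.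
  have hφ : Measurable[m] ({ω | 0 < h ω}.indicator fun ω => f ω * (ENNReal.ofReal (h ω))⁻¹) :=
    (hf.mul (ENNReal.measurable_ofReal.comp hhm).inv).indicator hs
  have hcond : ∫⁻ ω, ({ω | 0 < h ω}.indicator (fun ω => f ω * (ENNReal.ofReal (h ω))⁻¹) ω)
        * ENNReal.ofReal (density P Q i ω) ∂P
      = ∫⁻ ω, ({ω | 0 < h ω}.indicator (fun ω => f ω * (ENNReal.ofReal (h ω))⁻¹) ω)
        * ENNReal.ofReal (h ω) ∂P := by
    rw [← lintegral_mul_condLExp hm (measurable_density i).ennreal_ofReal.aemeasurable hφ]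
    refine lintegral_congr_ae ?_
    filter_upwards [condLExp_ofReal m (integrable_density hQ i)
      (ae_of_all _ fun ω => ENNReal.toReal_nonneg)] with ω hω
    rw [hω]
  have e1 : ∀ ω, f ω * ENNReal.ofReal (condDensity m P Q i ω)
      = ({ω | 0 < h ω}.indicator (fun ω => f ω * (ENNReal.ofReal (h ω))⁻¹) ω)
        * ENNReal.ofReal (density P Q i ω) + {ω | 0 < h ω}ᶜ.indicator f ω := fun ω => by
    by_cases hω : 0 < h ω
    · have : condDensity m P Q i ω = density P Q i ω / h ω := if_pos hω
      rw [this, ENNReal.ofReal_div_of_pos hω, Set.indicator_of_mem (by exact hω),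
        Set.indicator_of_notMem (by simpa using hω), div_eq_mul_inv, add_zero]
      ring
    · have : condDensity m P Q i ω = 1 := if_neg hω
      rw [this, Set.indicator_of_notMem (by exact hω), Set.indicator_of_mem (by exact hω)]
      simp
  have e2 : ∀ ω, f ω
      = ({ω | 0 < h ω}.indicator (fun ω => f ω * (ENNReal.ofReal (h ω))⁻¹) ω)
        * ENNReal.ofReal (h ω) + {ω | 0 < h ω}ᶜ.indicator f ω := fun ω => by
    by_cases hω : 0 < h ω
    · rw [Set.indicator_of_mem (by exact hω),
        Set.indicator_of_notMem (by simpa using hω), mul_assoc, ENNReal.inv_mul_cancel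
        (ENNReal.ofReal_pos.2 hω).ne' ENNReal.ofReal_ne_top, add_zero, mul_one]
    · rw [Set.indicator_of_notMem (by exact hω), Set.indicator_of_mem (by exact hω)]
      simp
  have hmeas : Measurable ({ω | 0 < h ω}ᶜ.indicator f) :=
    (hf.mono hm le_rfl).indicator (hm _ hs).compl
  rw [lintegral_congr e1, lintegral_add_right _ hmeas, hcond, ← lintegral_add_right _ hmeas]
  exact (lintegral_congr e2).symm

/-- The weight is nonnegative as soon as its product with the conditional density is. -/
lemma ae_nonneg_of_mul_condDensity [IsFiniteMeasure P] (hm : m ≤ mΩ) (hQ : IsVectorProb P Q)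
    (i : Fin d) {w : Ω → ℝ} (hw : AEStronglyMeasurable[m] w P)
    (h : ∀ᵐ ω ∂P, 0 ≤ w ω * condDensity m P Q i ω) : 0 ≤ᵐ[P] w := by
  obtain ⟨w', hw', hww'⟩ := hw
  -- On `{w' < 0}` the sign condition makes the conditional density nonpositive. As its conditional
  -- expectation is one, this set is null.
  have hs : MeasurableSet[m] {ω | w' ω < 0} := hw'.measurable measurableSet_Iio
  have h1 := lintegral_mul_condDensity (P := P) hm hQ i
    (f := {ω | w' ω < 0}.indicator 1) 
    ((show Measurable[m] (1 : Ω → ℝ≥0∞) from @measurable_const _ _ _ m 1).indicator hs)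
  rw [lintegral_indicator_one (hm _ hs)] at h1
  have h0 : ∫⁻ ω, {ω | w' ω < 0}.indicator 1 ω * ENNReal.ofReal (condDensity m P Q i ω) ∂P = 0 := by
    rw [← lintegral_zero (μ := P)]
    refine lintegral_congr_ae ?_
    filter_upwards [h, hww'] with ω hω he
    by_cases hn : w' ω < 0
    · have : condDensity m P Q i ω ≤ 0 := by
        rw [he] at hω
        exact nonpos_of_mul_nonneg_right hω hn
      simp [ENNReal.ofReal_of_nonpos this]
    · simp [Set.indicator_of_notMem (show ω ∉ {ω | w' ω < 0} from hn)]
  rw [h0] at h1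
  have hae : ∀ᵐ ω ∂P, ¬ w' ω < 0 := by
    rw [ae_iff]; simpa using h1.symm
  filter_upwards [hae, hww'] with ω h1 h2
  rw [h2]; exact not_lt.1 h1

lemma integral_mul_condDensity [IsFiniteMeasure P] (hm : m ≤ mΩ) (hQ : IsVectorProb P Q)
    (i : Fin d) {f : Ω → ℝ} (hf : AEStronglyMeasurable[m] f P) (hfi : Integrable f P)
    (hfc : Integrable (fun ω => f ω * condDensity m P Q i ω) P) :
    ∫ ω, f ω * condDensity m P Q i ω ∂P = ∫ ω, f ω ∂P := by
  have key : ∀ g : Ω → ℝ, AEStronglyMeasurable[m] g P →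
      ∫⁻ ω, ENNReal.ofReal (g ω * condDensity m P Q i ω) ∂P = ∫⁻ ω, ENNReal.ofReal (g ω) ∂P := by
    rintro g ⟨g', hg', hgg'⟩
    have hmeas : Measurable[m] fun ω => ENNReal.ofReal (g' ω) :=
      ENNReal.measurable_ofReal.comp hg'.measurable
    rw [lintegral_congr_ae (show (fun ω => ENNReal.ofReal (g ω)) =ᵐ[P]
      fun ω => ENNReal.ofReal (g' ω) by filter_upwards [hgg'] with ω h; rw [h]),
      ← lintegral_mul_condDensity hm hQ i hmeas]
    refine lintegral_congr_ae ?_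
    filter_upwards [hgg'] with ω h
    rw [ENNReal.ofReal_mul' (condDensity_nonneg i ω), h]
  rw [integral_eq_lintegral_pos_part_sub_lintegral_neg_part hfc,
    integral_eq_lintegral_pos_part_sub_lintegral_neg_part hfi, key f hf]
  have := key (fun ω => -f ω) hf.neg
  simp only [neg_mul] at this
  rw [this]

lemma pairing_eq_sum {f g : Ω → Vec d} (h : ∀ i, Integrable (fun ω => f ω i * g ω i) P) :
    pairing P f g = ∑ i, ∫ ω, f ω i * g ω i ∂P := by
  rw [← integral_finsetSum _ fun i _ => h i]
  refine integral_congr_ae (ae_of_all _ fun ω => ?_)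
  simp [PiLp.inner_apply, mul_comm]

lemma integrable_apply_mul_apply [hpq : p.HolderConjugate q] {f g : Ω → Vec d} (hf : MemLp f q P)
    (hg : MemLp g p P) (i : Fin d) : Integrable (fun ω => f ω i * g ω i) P := by
  have : q.HolderConjugate p := hpq.symm
  exact (hf.eval_piLp i).integrable_mul (hg.eval_piLp i)

lemma aestronglyMeasurable_apply {w : LpVec d q P} (hw : w ∈ LpSub m d q P) (i : Fin d) :
    AEStronglyMeasurable[m] (fun ω => w ω i) P :=
  (EuclideanSpace.proj (𝕜 := ℝ) i).continuous.comp_aestronglyMeasurable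
    (mem_lpMeas_iff_aestronglyMeasurable.1 hw)

/-- `E[wᵀ E^Q[X | m]] = E[(diag(w) ξ^Q)ᵀ X]`. -/
theorem pairing_condExpQ [IsFiniteMeasure P] [hpq : p.HolderConjugate q] (hm : m ≤ mΩ)
    (hQ : IsVectorProb P Q) {w : LpVec d q P} (hw : w ∈ LpSub m d q P)
    (hc : MemLp (couplingVec m P Q w) q P) (hc0 : ∀ᵐ ω ∂P, ∀ i, 0 ≤ couplingVec m P Q w ω i)
    (X : LpVec d p P) :
    pairing P w (condExpQ m P Q X) = pairing P (couplingVec m P Q w) X := by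
  have hint : ∀ i, Integrable (fun ω => w ω i * (condDensity m P Q i ω * X ω i)) P := fun i => by
    have := integrable_apply_mul_apply hc (Lp.memLp X) i
    simpa only [couplingVec, mul_assoc] using this
  have key := fun i => integral_mul_generalizedCondExp hm (aestronglyMeasurable_apply hw i)
    (ae_nonneg_of_mul_condDensity hm hQ i (aestronglyMeasurable_apply hw i)
      (by filter_upwards [hc0] with ω h using h i))
    ((measurable_condDensity hm i).aemeasurable.mul
      ((Lp.memLp X).eval_piLp i).aestronglyMeasurable.aemeasurable) (hint i)
  rw [pairing_eq_sum fun i => (key i).1,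
    pairing_eq_sum fun i => integrable_apply_mul_apply hc (Lp.memLp X) i]
  refine Finset.sum_congr rfl fun i _ => ?_
  refine (key i).2.trans ?_
  simp only [couplingVec, Pi.mul_apply, mul_assoc]

/-- On `m`-measurable vectors the weights `diag(w) ξ^Q` and `w` agree. -/
theorem pairing_couplingVec [IsFiniteMeasure P] [hpq : p.HolderConjugate q] (hm : m ≤ mΩ)
    (hQ : IsVectorProb P Q) {w : LpVec d q P} (hw : w ∈ LpSub m d q P)
    (hc : MemLp (couplingVec m P Q w) q P) {u : LpVec d p P} (hu : u ∈ LpSub m d p P) :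
    pairing P (couplingVec m P Q w) u = pairing P w u := by
  rw [pairing_eq_sum fun i => integrable_apply_mul_apply hc (Lp.memLp u) i,
    pairing_eq_sum fun i => integrable_apply_mul_apply (Lp.memLp w) (Lp.memLp u) i]
  refine Finset.sum_congr rfl fun i _ => ?_
  have h1 := integrable_apply_mul_apply hc (Lp.memLp u) i
  have e : (fun ω => couplingVec m P Q w ω i * u ω i)
      = fun ω => w ω i * u ω i * condDensity m P Q i ω := by
    funext ω; simp only [couplingVec]; ring
  rw [e] at h1 ⊢
  exact integral_mul_condDensity hm hQ i (f := fun ω => w ω i * u ω i)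
    ((aestronglyMeasurable_apply hw i).mul (aestronglyMeasurable_apply hu i))
    (integrable_apply_mul_apply (Lp.memLp w) (Lp.memLp u) i) h1

end Bayes

/-! ### Riesz representation of positive functionals on `L^p`, `p < ∞` -/

section Riesz

variable {Ω : Type*} {mΩ : MeasurableSpace Ω} {P : Measure Ω} [IsFiniteMeasure P] {p q : ℝ≥0∞}

lemma indicatorConstLp_eq_smul {B : Set Ω} (hB : MeasurableSet B) (c : ℝ) :
    indicatorConstLp p hB (measure_ne_top P B) c
      = c • indicatorConstLp p hB (measure_ne_top P B) (1 : ℝ) := by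
  rw [indicatorConstLp, indicatorConstLp, ← MemLp.toLp_const_smul]
  congr 1
  ext ω
  by_cases h : ω ∈ B <;> simp [h]

lemma memLp_simpleFunc_nnreal (s : SimpleFunc Ω NNReal) :
    MemLp (fun ω => (s ω : ℝ)) p P :=
  (SimpleFunc.memLp_of_isFiniteMeasure (s.map ((↑) : NNReal → ℝ)) p P)

variable [Fact (1 ≤ p)]

/-- The measure defined by a positive functional on `L^p`, `p < ∞`. -/
lemma exists_measure_of_positive (hp : p ≠ ∞) (ψ : Lp ℝ p P →L[ℝ] ℝ)
    (hψ : ∀ f : Lp ℝ p P, 0 ≤ᵐ[P] f → 0 ≤ ψ f) :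
    ∃ ν : Measure Ω, IsFiniteMeasure ν ∧ ν ≪ P ∧ ∀ (B : Set Ω) (hB : MeasurableSet B),
      ν B = ENNReal.ofReal (ψ (indicatorConstLp p hB (measure_ne_top P B) 1)) := by
  have hp0 : p ≠ 0 := (zero_lt_one.trans_le (Fact.out : 1 ≤ p)).ne'
  have hnn : ∀ (B : Set Ω) (hB : MeasurableSet B),
      0 ≤ ψ (indicatorConstLp p hB (measure_ne_top P B) 1) := fun B hB => by
    refine hψ _ ?_
    filter_upwards [indicatorConstLp_coeFn (p := p) (hs := hB) (hμs := measure_ne_top P B)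
      (c := (1 : ℝ))] with ω h
    rw [h]
    exact Set.indicator_nonneg (fun _ _ => zero_le_one) ω
  have hadd : ∀ ⦃f : ℕ → Set Ω⦄ (h : ∀ i, MeasurableSet (f i)), Pairwise (Function.onFun Disjoint f) →
      ENNReal.ofReal (ψ (indicatorConstLp p (MeasurableSet.iUnion h) (measure_ne_top P _) 1)) =
        ∑' i, ENNReal.ofReal (ψ (indicatorConstLp p (h i) (measure_ne_top P _) 1)) := by
    intro f hf hd
    have hA : ∀ n, MeasurableSet (⋃ i ∈ Finset.range n, f i) := fun n =>
      Finset.measurableSet_biUnion _ fun i _ => hf i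
    have hsum : ∀ n, indicatorConstLp p (hA n) (measure_ne_top P _) (1 : ℝ) =
        ∑ i ∈ Finset.range n, indicatorConstLp p (hf i) (measure_ne_top P _) 1 := fun n => by
      induction n with
      | zero => simp
      | succ n ih =>
        rw [Finset.sum_range_succ, ← ih, ← indicatorConstLp_disjoint_union (hA n) (hf n)]
        · congr 1
          rw [Finset.range_add_one, Finset.set_biUnion_insert, Set.union_comm]
        · rw [Set.disjoint_iUnion₂_left]
          exact fun i hi => hd (Finset.mem_range.1 hi).ne
    -- Countable additivity rests on norm convergence of the indicators of the partial unions, which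
    -- requires `p < ∞`.
    have hlim : Filter.Tendsto (fun n => indicatorConstLp p (hA n) (measure_ne_top P _) (1 : ℝ))
        Filter.atTop
        (𝓝 (indicatorConstLp p (MeasurableSet.iUnion hf) (measure_ne_top P _) (1 : ℝ))) := by
      refine tendsto_indicatorConstLp_set hp ?_
      have hsub : ∀ n, (⋃ i ∈ Finset.range n, f i) ⊆ ⋃ i, f i := fun n =>
        Set.iUnion₂_subset fun i _ => Set.subset_iUnion f i
      have heq : ∀ n, symmDiff (⋃ i ∈ Finset.range n, f i) (⋃ i, f i) =
          (⋃ i, f i) \ ⋃ i ∈ Finset.range n, f i := fun n => symmDiff_of_le (hsub n)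
      simp only [heq]
      have hanti : Antitone fun n => (⋃ i, f i) \ ⋃ i ∈ Finset.range n, f i := fun a b hab =>
        Set.sdiff_subset_sdiff_right (Set.biUnion_mono
          (fun i hi => Finset.mem_range.2 ((Finset.mem_range.1 hi).trans_le hab))
          fun _ _ => subset_rfl)
      have h0 : ⋂ n, ((⋃ i, f i) \ ⋃ i ∈ Finset.range n, f i) = ∅ := by
        rw [Set.eq_empty_iff_forall_notMem]
        intro ω hω
        rw [Set.mem_iInter] at hω
        obtain ⟨i, hi⟩ := Set.mem_iUnion.1 (hω 0).1
        exact (hω (i + 1)).2 (Set.mem_iUnion₂.2 ⟨i, by simp, hi⟩)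
      have := tendsto_measure_iInter_atTop (μ := P) (fun n =>
        ((MeasurableSet.iUnion hf).diff (hA n)).nullMeasurableSet) hanti ⟨0, measure_ne_top P _⟩
      rwa [h0, measure_empty] at this
    refine ((ENNReal.hasSum_iff_tendsto_nat _).2 ?_).tsum_eq.symm
    have h1 := ENNReal.tendsto_ofReal ((ψ.continuous.tendsto _).comp hlim)
    refine h1.congr fun n => ?_
    rw [Function.comp_apply, hsum, map_sum, ENNReal.ofReal_sum_of_nonneg fun i _ => hnn _ _]
  refine ⟨Measure.ofMeasurable (fun B hB => ENNReal.ofReal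
    (ψ (indicatorConstLp p hB (measure_ne_top P B) 1))) (by simp) hadd, ⟨?_⟩, ?_, ?_⟩
  · rw [Measure.ofMeasurable_apply _ MeasurableSet.univ]
    exact ENNReal.ofReal_lt_top
  · refine Measure.AbsolutelyContinuous.mk fun B hB hB0 => ?_
    rw [Measure.ofMeasurable_apply _ hB]
    have : indicatorConstLp p hB (measure_ne_top P B) (1 : ℝ) = 0 := by
      rw [← norm_eq_zero, norm_indicatorConstLp hp0 hp]
      simp [Measure.real, hB0, ENNReal.toReal_eq_zero_iff, hp0, hp]
    simp [this]
  · exact fun B hB => Measure.ofMeasurable_apply _ hB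

variable {ν : Measure Ω} {ψ : Lp ℝ p P →L[ℝ] ℝ}

lemma lintegral_simpleFunc_eq (hψ : ∀ f : Lp ℝ p P, 0 ≤ᵐ[P] f → 0 ≤ ψ f)
    (hν : ∀ (B : Set Ω) (hB : MeasurableSet B),
      ν B = ENNReal.ofReal (ψ (indicatorConstLp p hB (measure_ne_top P B) 1)))
    (s : SimpleFunc Ω NNReal) :
    ∫⁻ ω, s ω ∂ν = ENNReal.ofReal (ψ ((memLp_simpleFunc_nnreal s).toLp _)) := by
  induction s using SimpleFunc.induction with
  | @const c B hB =>
    have h1 : ∀ ω, ((SimpleFunc.piecewise B hB (SimpleFunc.const Ω c) (SimpleFunc.const Ω 0) ω : NNReal)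
        : ℝ≥0∞) = B.indicator (fun _ => (c : ℝ≥0∞)) ω := fun ω => by
      by_cases h : ω ∈ B <;> simp [h]
    have h3 : (memLp_simpleFunc_nnreal (p := p) (P := P)
        (SimpleFunc.piecewise B hB (SimpleFunc.const Ω c) (SimpleFunc.const Ω 0))).toLp _
        = indicatorConstLp p hB (measure_ne_top P B) (c : ℝ) := by
      rw [indicatorConstLp]; congr 1
      ext ω; by_cases h : ω ∈ B <;> simp [h]
    rw [h3, indicatorConstLp_eq_smul, map_smul, smul_eq_mul, ENNReal.ofReal_mul c.coe_nonneg, ← hν B hB,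
      lintegral_congr h1, lintegral_indicator_const hB]
    simp
  | @add f g _ hf hg =>
    have h3 : (memLp_simpleFunc_nnreal (p := p) (P := P) (f + g)).toLp _
        = (memLp_simpleFunc_nnreal (p := p) (P := P) f).toLp _
          + (memLp_simpleFunc_nnreal (p := p) (P := P) g).toLp _ := by
      rw [← MemLp.toLp_add]; congr 1
    have hnn : ∀ s : SimpleFunc Ω NNReal,
        0 ≤ ψ ((memLp_simpleFunc_nnreal (p := p) (P := P) s).toLp _) := fun s => by
      refine hψ _ ?_
      filter_upwards [(memLp_simpleFunc_nnreal (p := p) (P := P) s).coeFn_toLp] with ω h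
      rw [h]; exact (s ω).2
    rw [h3, map_add, ENNReal.ofReal_add (hnn f) (hnn g), ← hf, ← hg,
      ← lintegral_add_left (f.measurable.coe_nnreal_ennreal)]
    simp

/-- Hölder's inequality for the measure of a positive functional. -/
lemma lintegral_le_of_positive (hp : p ≠ ∞) (hψ : ∀ f : Lp ℝ p P, 0 ≤ᵐ[P] f → 0 ≤ ψ f)
    (hν : ∀ (B : Set Ω) (hB : MeasurableSet B),
      ν B = ENNReal.ofReal (ψ (indicatorConstLp p hB (measure_ne_top P B) 1)))
    (f : Ω → ℝ≥0∞) :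
    ∫⁻ ω, f ω ∂ν ≤ ‖ψ‖ₑ * (∫⁻ ω, f ω ^ p.toReal ∂P) ^ (1 / p.toReal) := by
  have hp0 : p ≠ 0 := (zero_lt_one.trans_le (Fact.out : 1 ≤ p)).ne'
  rw [lintegral_eq_nnreal]
  refine iSup₂_le fun s hs => ?_
  rw [← SimpleFunc.lintegral_eq_lintegral]
  simp only [SimpleFunc.map_apply]
  rw [lintegral_simpleFunc_eq hψ hν s]
  calc ENNReal.ofReal (ψ ((memLp_simpleFunc_nnreal s).toLp _))
      ≤ ‖ψ ((memLp_simpleFunc_nnreal s).toLp _)‖ₑ := Real.ofReal_le_enorm _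
    _ ≤ ‖ψ‖ₑ * ‖(memLp_simpleFunc_nnreal (p := p) (P := P) s).toLp _‖ₑ := ψ.le_opENorm _
    _ ≤ _ := by
      gcongr
      rw [Lp.enorm_toLp, eLpNorm_eq_lintegral_rpow_enorm_toReal hp0 hp]
      gcongr with ω
      simpa using hs ω

/-- For finite nonzero `I` one may divide by `I ^ (1 / pr)`, which leaves `I ^ (1 / qr) ≤ C`. -/
lemma rpow_le_of_le_mul_rpow {pr qr : ℝ} (hpq : pr.HolderConjugate qr) {I C : ℝ≥0∞} (hI : I ≠ ∞)
    (h : I ≤ C * I ^ (1 / pr)) : I ≤ C ^ qr := by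
  rcases eq_or_ne I 0 with rfl | h0
  · exact zero_le
  have h1 : I ^ (1 / pr) ≠ 0 := by simp [ENNReal.rpow_eq_zero_iff, h0, hI]
  have h2 : I ^ (1 / pr) ≠ ∞ := ENNReal.rpow_ne_top_of_nonneg (by have := hpq.pos; positivity) hI
  have h3 : I ^ (1 / qr) * I ^ (1 / pr) = I := by
    rw [← ENNReal.rpow_add _ _ h0 hI, one_div, one_div, add_comm, hpq.inv_add_inv_eq_one,
      ENNReal.rpow_one]
  have h4 : I ^ (1 / qr) ≤ C := by
    rw [← ENNReal.mul_le_mul_iff_left h1 h2, h3]; exact h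
  calc I = (I ^ (1 / qr)) ^ qr := by
        rw [← ENNReal.rpow_mul, one_div_mul_cancel hpq.symm.ne_zero, ENNReal.rpow_one]
    _ ≤ C ^ qr := ENNReal.rpow_le_rpow h4 hpq.symm.pos.le

/-- This converse of Hölder's inequality uses the extremal test function `min (G, n) ^ (qr - 1)`.
The truncation makes the integral finite, so that it can be divided out; monotone convergence then
removes `n`. -/
lemma lintegral_rpow_le_of_forall {pr qr : ℝ} (hpq : pr.HolderConjugate qr) {C : ℝ≥0∞}
    {G : Ω → ℝ≥0∞} (hG : Measurable G)
    (h : ∀ f : Ω → ℝ≥0∞, Measurable f →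
      ∫⁻ ω, G ω * f ω ∂P ≤ C * (∫⁻ ω, f ω ^ pr ∂P) ^ (1 / pr)) :
    ∫⁻ ω, G ω ^ qr ∂P ≤ C ^ qr := by
  have hq := hpq.symm.pos
  have hn : ∀ n : ℕ, ∫⁻ ω, (min (G ω) n) ^ qr ∂P ≤ C ^ qr := fun n => by
    refine rpow_le_of_le_mul_rpow hpq ?_ ?_
    · refine ((lintegral_mono fun ω =>
        ENNReal.rpow_le_rpow (min_le_right (G ω) n) hq.le).trans_lt ?_).ne
      rw [lintegral_const]
      exact ENNReal.mul_lt_top (ENNReal.rpow_lt_top_of_nonneg hq.le (ENNReal.natCast_ne_top n))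
        (measure_lt_top P _)
    · have h1 := h (fun ω => (min (G ω) n) ^ (qr - 1)) ((hG.min measurable_const).pow_const _)
      have h2 : ∀ ω, ((min (G ω) n) ^ (qr - 1)) ^ pr = (min (G ω) n) ^ qr := fun ω => by
        rw [← ENNReal.rpow_mul, hpq.symm.sub_one_mul_conj]
      simp only [h2] at h1
      refine le_trans (lintegral_mono fun ω => ?_) h1
      have : (min (G ω) n) ^ qr = min (G ω) n * (min (G ω) n) ^ (qr - 1) := by
        conv_lhs => rw [show qr = 1 + (qr - 1) by ring]
        rw [ENNReal.rpow_add_of_nonneg _ _ zero_le_one hpq.symm.sub_one_pos.le, ENNReal.rpow_one]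
      simp only [this]
      gcongr
      exact min_le_left _ _
  have hlim : Filter.Tendsto (fun n : ℕ => ∫⁻ ω, (min (G ω) n) ^ qr ∂P) Filter.atTop
      (𝓝 (∫⁻ ω, G ω ^ qr ∂P)) := by
    refine lintegral_tendsto_of_tendsto_of_monotone
      (fun n => ((hG.min measurable_const).pow_const _).aemeasurable)
      (ae_of_all _ fun ω a b hab => ?_) (ae_of_all _ fun ω => ?_)
    · exact ENNReal.rpow_le_rpow (min_le_min le_rfl (by exact_mod_cast hab)) hq.le
    · have := (tendsto_const_nhds (x := G ω)).min ENNReal.tendsto_nat_nhds_top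
      rw [min_eq_left le_top] at this
      exact (ENNReal.continuous_rpow_const.tendsto _).comp this
  exact le_of_tendsto' hlim hn

/-- Riesz representation of positive functionals on `L^p`, `p < ∞`. -/
theorem exists_integral_of_positive [hpq : p.HolderConjugate q] (hp : p ≠ ∞)
    (ψ : Lp ℝ p P →L[ℝ] ℝ) (hψ : ∀ f : Lp ℝ p P, 0 ≤ᵐ[P] f → 0 ≤ ψ f) :
    ∃ g : Ω → ℝ, MemLp g q P ∧ ∀ f : Lp ℝ p P, ψ f = ∫ ω, g ω * f ω ∂P := by
  obtain ⟨ν, hfin, hac, hν⟩ := exists_measure_of_positive hp ψ hψ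
  have hp0 : p ≠ 0 := (zero_lt_one.trans_le (Fact.out : 1 ≤ p)).ne'
  set G := ν.rnDeriv P with hGdef
  have hG : Measurable G := Measure.measurable_rnDeriv ν P
  have hGν : P.withDensity G = ν := Measure.withDensity_rnDeriv_eq ν P hac
  have hbound : ∀ f : Ω → ℝ≥0∞, Measurable f →
      ∫⁻ ω, G ω * f ω ∂P ≤ ‖ψ‖ₑ * (∫⁻ ω, f ω ^ p.toReal ∂P) ^ (1 / p.toReal) := fun f hf => by
    refine le_trans (le_of_eq ?_) (lintegral_le_of_positive hp hψ hν f)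
    conv_rhs => rw [← hGν]
    rw [lintegral_withDensity_eq_lintegral_mul _ hG hf]
    rfl
  have hGtop : ∀ᵐ ω ∂P, G ω < ∞ := Measure.rnDeriv_lt_top ν P
  have hmem : MemLp (fun ω => (G ω).toReal) q P := by
    refine ⟨hG.ennreal_toReal.aestronglyMeasurable, ?_⟩
    have hle : ∀ ω, ‖(G ω).toReal‖ₑ ≤ G ω := fun ω => by
      rw [Real.enorm_of_nonneg ENNReal.toReal_nonneg]; exact ENNReal.ofReal_toReal_le
    rcases (Fact.out : 1 ≤ p).eq_or_lt with h1 | h1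
    · obtain rfl : p = 1 := h1.symm
      have : q.HolderConjugate 1 := hpq.symm
      obtain rfl : q = ∞ := (ENNReal.HolderConjugate.eq_top_iff_eq_one q 1).2 rfl
      rw [eLpNorm_exponent_top]
      have hle' : G ≤ᵐ[P] fun _ => ‖ψ‖ₑ := by
        refine ae_le_of_forall_setLIntegral_le_of_sigmaFinite hG fun s hs _ => ?_
        -- For `p = 1`, testing with indicators bounds the integral of `G` over `s` by `‖ψ‖ₑ * P s`,
        -- hence `G` by `‖ψ‖ₑ` almost everywhere.
        have := hbound (s.indicator 1) (measurable_one.indicator hs)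
        have e1 : ∀ ω, G ω * s.indicator 1 ω = s.indicator G ω := fun ω => by
          by_cases h : ω ∈ s <;> simp [h]
        simp only [e1, ENNReal.toReal_one, ENNReal.rpow_one, div_one] at this
        rw [lintegral_indicator hs, lintegral_indicator_one hs] at this
        simpa using this
      refine lt_of_le_of_lt (eLpNormEssSup_le_of_ae_enorm_bound (C := ‖ψ‖ₑ) ?_) enorm_lt_top
      filter_upwards [hle'] with ω h
      exact (hle ω).trans h
    · have : q.HolderConjugate p := hpq.symm
      have hq0 : q ≠ 0 := ENNReal.HolderConjugate.ne_zero q p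
      have hqt : q ≠ ∞ := (ENNReal.HolderConjugate.ne_top_iff_ne_one q p).2 h1.ne'
      have hr : p.toReal.HolderConjugate q.toReal :=
        ENNReal.HolderConjugate.toReal_of_ne_top hp hqt
      rw [eLpNorm_eq_lintegral_rpow_enorm_toReal hq0 hqt]
      refine ENNReal.rpow_lt_top_of_nonneg (by positivity) (ne_of_lt ?_)
      refine lt_of_le_of_lt (lintegral_mono fun ω => ENNReal.rpow_le_rpow (hle ω) hr.symm.pos.le) ?_
      exact (lintegral_rpow_le_of_forall hr hG hbound).trans_lt
        (ENNReal.rpow_lt_top_of_nonneg hr.symm.pos.le enorm_ne_top)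
  refine ⟨_, hmem, fun f => ?_⟩
  have : q.HolderConjugate p := hpq.symm
  have : Fact (1 ≤ q) := ⟨ENNReal.HolderConjugate.one_le q p⟩
  have hΛ : ∀ f : Lp ℝ p P, (ContinuousLinearMap.mul ℝ ℝ).lpPairing P q p (hmem.toLp _) f
      = ∫ ω, (G ω).toReal * f ω ∂P := fun f => by
    rw [ContinuousLinearMap.lpPairing_eq_integral]
    refine integral_congr_ae ?_
    filter_upwards [hmem.coeFn_toLp] with ω h
    simp [h]
  rw [← hΛ]
  induction f using Lp.induction hp with
  | indicatorConst c hs hμs =>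
    rename_i s
    rw [Lp.simpleFunc.coe_indicatorConst, indicatorConstLp_eq_smul hs c, map_smul, map_smul, hΛ]
    congr 1
    have : ∫ ω, (G ω).toReal * indicatorConstLp p hs (measure_ne_top P s) (1 : ℝ) ω ∂P = ν.real s := by
      rw [← Measure.setIntegral_toReal_rnDeriv hac s, ← integral_indicator hs]
      refine integral_congr_ae ?_
      filter_upwards [indicatorConstLp_coeFn (p := p) (hs := hs) (hμs := measure_ne_top P s)
        (c := (1 : ℝ))] with ω h
      rw [h]
      by_cases hω : ω ∈ s <;> simp [hω, hGdef]
    rw [this, Measure.real, hν s hs, ENNReal.toReal_ofReal]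
    refine hψ _ ?_
    filter_upwards [indicatorConstLp_coeFn (p := p) (hs := hs) (hμs := measure_ne_top P s)
      (c := (1 : ℝ))] with ω h
    rw [h]
    exact Set.indicator_nonneg (fun _ _ => zero_le_one) ω
  | add hf hg _ h1 h2 => rw [map_add, map_add, h1, h2]
  | isClosed => exact isClosed_eq ψ.continuous (ContinuousLinearMap.continuous _)

end Riesz

/-! ### The topologies of `L^p_d`, their positive functionals, and dual variables -/

section Duality

variable {Ω : Type*} {m mΩ : MeasurableSpace Ω} {P : Measure Ω} {d : ℕ} {p q : ℝ≥0∞}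

lemma pairing_comm (f g : Ω → Vec d) : pairing P f g = pairing P g f := by
  simp only [pairing, real_inner_comm]

lemma pairing_congr_left {f f' : Ω → Vec d} (h : f =ᵐ[P] f') (g : Ω → Vec d) :
    pairing P f g = pairing P f' g := by
  refine integral_congr_ae ?_
  filter_upwards [h] with ω h
  rw [h]

lemma pairing_eq_lpPairing [hpq : p.HolderConjugate q] [Fact (1 ≤ p)] [Fact (1 ≤ q)]
    (v : LpVec d q P) (X : LpVec d p P) :
    pairing P v X = (innerSL ℝ).lpPairing P p q X v := by
  rw [ContinuousLinearMap.lpPairing_eq_integral, pairing_comm]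
  rfl

/-- The pairing with `v ∈ L^q_d`, as a linear functional on `L^p_d`. -/
noncomputable def pairingLinear [hpq : p.HolderConjugate q] [Fact (1 ≤ p)] [Fact (1 ≤ q)] (v : LpVec d q P) :
    LpVec d p P →ₗ[ℝ] ℝ where
  toFun X := pairing P v X
  map_add' X Y := by simp only [pairing_eq_lpPairing, map_add, add_apply]
  map_smul' r X := by
    simp only [pairing_eq_lpPairing, map_smul, smul_apply, RingHom.id_apply]

lemma topo_of_ne_top [Fact (1 ≤ p)] (hp : p ≠ ∞) :
    topo d p P = (inferInstance : TopologicalSpace (LpVec d p P)) := if_neg hp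

/-- The pairing of `L^∞_d` and `L^1_d`. -/
noncomputable def topPairing (d : ℕ) (P : Measure Ω) : LpVec d ∞ P →ₗ[ℝ] LpVec d 1 P →ₗ[ℝ] ℝ :=
  LinearMap.mk₂ ℝ (fun X Y => (innerSL ℝ).lpPairing P ∞ 1 X Y) (by simp) (by simp) (by simp)
    (by simp)

/-- Through this identification the case `p = ∞` inherits the vector space topology, local convexity
and the dual `L^1_d` from the general theory of weak topologies of bilinear pairings. -/
lemma topo_top : topo d ∞ P = (inferInstance : TopologicalSpace (WeakBilin (topPairing d P))) := by
  refine (if_pos rfl).trans ?_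
  have : (fun (X : LpVec d ∞ P) (Y : LpVec d 1 P) => pairing P X Y)
      = fun X Y => topPairing d P X Y := by
    funext X Y
    rw [pairing_comm, pairing_eq_lpPairing]
    rfl
  rw [weakStar, this]
  rfl

lemma topo_isTopologicalAddGroup [Fact (1 ≤ p)] :
    @IsTopologicalAddGroup (LpVec d p P) (topo d p P) _ := by
  by_cases hp : p = ∞
  · subst hp
    rw [topo_top]
    exact (inferInstance : IsTopologicalAddGroup (WeakBilin (topPairing d P)))
  · rw [topo_of_ne_top hp]
    infer_instance

lemma topo_continuousSMul [Fact (1 ≤ p)] :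
    @ContinuousSMul ℝ (LpVec d p P) _ _ (topo d p P) := by
  by_cases hp : p = ∞
  · subst hp
    rw [topo_top]
    exact (inferInstance : ContinuousSMul ℝ (WeakBilin (topPairing d P)))
  · rw [topo_of_ne_top hp]
    infer_instance

lemma topo_locallyConvexSpace [Fact (1 ≤ p)] :
    @LocallyConvexSpace ℝ (LpVec d p P) _ _ _ _ (topo d p P) := by
  by_cases hp : p = ∞
  · subst hp
    rw [topo_top]
    exact (inferInstance : LocallyConvexSpace ℝ (WeakBilin (topPairing d P)))
  · rw [topo_of_ne_top hp]
    infer_instance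

lemma continuous_pairing [hpq : p.HolderConjugate q] [Fact (1 ≤ p)] (v : LpVec d q P) :
    Continuous[topo d p P, _] fun X : LpVec d p P => pairing P v X := by
  have : q.HolderConjugate p := hpq.symm
  have : Fact (1 ≤ q) := ⟨ENNReal.HolderConjugate.one_le q p⟩
  simp only [pairing_eq_lpPairing]
  by_cases hp : p = ∞
  · subst hp
    obtain rfl : q = 1 := (ENNReal.HolderConjugate.eq_top_iff_eq_one ∞ q).1 rfl
    rw [topo_top]
    exact WeakBilin.eval_continuous (topPairing d P) v
  · rw [topo_of_ne_top hp]
    exact ((innerSL ℝ).lpPairing P p q).continuous.clm_apply continuous_const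

/-- The positive continuous functionals on `L^p_d` are given by elements of `L^q_d`. -/
theorem exists_pairing_of_positive [IsFiniteMeasure P] [hpq : p.HolderConjugate q] [Fact (1 ≤ p)]
    (φ : LpVec d p P →ₗ[ℝ] ℝ) (hφ : Continuous[topo d p P, _] φ)
    (hpos : ∀ X ∈ nonneg d p P, 0 ≤ φ X) :
    ∃ v : LpVec d q P, ∀ X : LpVec d p P, φ X = pairing P v X := by
  have : q.HolderConjugate p := hpq.symm
  have : Fact (1 ≤ q) := ⟨ENNReal.HolderConjugate.one_le q p⟩
  by_cases hp : p = ∞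
  · subst hp
    obtain rfl : q = 1 := (ENNReal.HolderConjugate.eq_top_iff_eq_one ∞ q).1 rfl
    rw [topo_top] at hφ
    obtain ⟨v, hv⟩ := LinearMap.dualEmbedding_surjective (topPairing d P)
      (⟨φ, hφ⟩ : StrongDual ℝ (WeakBilin (topPairing d P)))
    refine ⟨v, fun X => ?_⟩
    rw [pairing_eq_lpPairing]
    exact (DFunLike.congr_fun hv X).symm
  · rw [topo_of_ne_top hp] at hφ
    let Φ : LpVec d p P →L[ℝ] ℝ := ⟨φ, hφ⟩
    let e : Fin d → (ℝ →L[ℝ] Vec d) := fun i =>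
      (ContinuousLinearMap.id ℝ ℝ).smulRight (EuclideanSpace.single i (1 : ℝ))
    have he : ∀ i (r : ℝ) j, e i r j = if j = i then r else 0 := fun i r j => by
      simp [e, PiLp.single_apply]
    -- For `p < ∞` the scalar representation is applied to each coordinate embedding; these preserve
    -- positivity.
    have key := fun i => exists_integral_of_positive (q := q) hp (Φ.comp ((e i).compLpL p P))
      (fun f hf => hpos _ (by
        filter_upwards [ContinuousLinearMap.coeFn_compLpL (p := p) (μ := P) (e i) f, hf]
          with ω h1 h2 j
        have h3 := congrArg (fun x : Vec d => x j) h1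
        refine le_of_le_of_eq ?_ h3.symm
        rw [he]
        split_ifs
        exacts [h2, le_rfl]))
    choose g hg hgφ using key
    have hmem : MemLp (fun ω => (WithLp.toLp 2 fun i => g i ω : Vec d)) q P :=
      MemLp.of_eval_piLp hg
    refine ⟨hmem.toLp _, fun X => ?_⟩
    let X' : Fin d → Lp ℝ p P := fun i =>
      (EuclideanSpace.proj i : Vec d →L[ℝ] ℝ).compLpL p P X
    have hX' : ∀ i, X' i =ᵐ[P] fun ω => X ω i := fun i =>
      ContinuousLinearMap.coeFn_compLpL _ X
    have hX : X = ∑ i, (e i).compLpL p P (X' i) := by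
      ext1
      have h1 : ∀ᵐ ω ∂P, ∀ i, (e i).compLpL p P (X' i) ω = e i (X ω i) := ae_all_iff.2 fun i => by
        filter_upwards [ContinuousLinearMap.coeFn_compLpL (p := p) (μ := P) (e i) (X' i), hX' i]
          with ω h1 h2
        rw [h1, h2]
      filter_upwards [h1, Lp.coeFn_finsetSum Finset.univ fun i => (e i).compLpL p P (X' i)]
        with ω h1 h2
      rw [h2, Finset.sum_apply]
      ext j
      simp [h1, he]
    have h2 : Φ X = ∑ i, ∫ ω, g i ω * X' i ω ∂P := by
      conv_lhs => rw [hX]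
      rw [map_sum]
      exact Finset.sum_congr rfl fun i _ => hgφ i (X' i)
    rw [pairing_congr_left hmem.coeFn_toLp,
      pairing_eq_sum fun i => integrable_apply_mul_apply hmem (Lp.memLp X) i]
    refine h2.trans (Finset.sum_congr rfl fun i _ => integral_congr_ae ?_)
    filter_upwards [hX' i] with ω h
    rw [h]

/-- Testing with indicators times basis vectors shows that each coordinate has nonnegative integral
over every measurable set. -/
lemma nonneg_of_pairing_nonneg [IsFiniteMeasure P] [hpq : p.HolderConjugate q] {v : LpVec d q P}
    (h : ∀ X ∈ nonneg d p P, 0 ≤ pairing P v X) : v ∈ nonneg d q P := by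
  have : q.HolderConjugate p := hpq.symm
  refine ae_all_iff.2 fun i => ?_
  have hint : Integrable (fun ω => v ω i) P :=
    ((Lp.memLp v).eval_piLp i).integrable (ENNReal.HolderConjugate.one_le q p)
  refine ae_nonneg_of_forall_setIntegral_nonneg hint fun s hs _ => ?_
  have hc := indicatorConstLp_coeFn (p := p) (hs := hs) (hμs := measure_ne_top P s)
    (c := (EuclideanSpace.single i (1 : ℝ) : Vec d))
  have h0 := h (indicatorConstLp p hs (measure_ne_top P s) (EuclideanSpace.single i (1 : ℝ))) (by
    filter_upwards [hc] with ω hω j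
    rw [hω]
    by_cases hs : ω ∈ s
    · simp only [Set.indicator_of_mem hs, PiLp.single_apply]
      split_ifs <;> norm_num
    · simp [Set.indicator_of_notMem hs])
  rw [← integral_indicator hs]
  refine h0.trans_eq (integral_congr_ae ?_)
  filter_upwards [hc] with ω hω
  rw [hω]
  by_cases hs : ω ∈ s
  · simp [Set.indicator_of_mem hs, EuclideanSpace.inner_single_right]
  · simp [Set.indicator_of_notMem hs]

lemma pairing_nonneg {f g : Ω → Vec d} (hf : ∀ᵐ ω ∂P, ∀ i, 0 ≤ f ω i)
    (hg : ∀ᵐ ω ∂P, ∀ i, 0 ≤ g ω i) : 0 ≤ pairing P f g := by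
  refine integral_nonneg_of_ae ?_
  filter_upwards [hf, hg] with ω h1 h2
  rw [PiLp.inner_apply]
  exact Finset.sum_nonneg fun i _ => by simpa using mul_nonneg (h2 i) (h1 i)

/-- The set where the conditional expectation is nonpositive is `m`-measurable, so the integral of
`f` over it is both nonpositive and nonnegative. -/
lemma eq_zero_of_condExp_nonpos [IsFiniteMeasure P] (hm : m ≤ mΩ) {f : Ω → ℝ}
    (hf : Integrable f P) (hf0 : 0 ≤ᵐ[P] f) : ∀ᵐ ω ∂P, condExp m P f ω ≤ 0 → f ω = 0 := by
  have hs : MeasurableSet[m] {ω | condExp m P f ω ≤ 0} :=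
    (stronglyMeasurable_condExp (m := m) (μ := P) (f := f)).measurable measurableSet_Iic
  have h1 : ∫ ω in {ω | condExp m P f ω ≤ 0}, f ω ∂P = 0 := by
    refine le_antisymm ?_ (integral_nonneg_of_ae (ae_restrict_of_ae hf0))
    rw [← setIntegral_condExp hm hf hs]
    exact setIntegral_nonpos (hm _ hs) fun ω hω => hω
  have h2 := (setIntegral_eq_zero_iff_of_nonneg_ae (ae_restrict_of_ae hf0) hf.integrableOn).1 h1
  exact (ae_restrict_iff' (hm _ hs)).1 h2

/-- Every nonnegative integrable `f` defines a probability measure whose density with respect to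
`P` is proportional to `f`. -/
lemma exists_prob_density [IsProbabilityMeasure P] {f : Ω → ℝ} (hfm : Measurable f)
    (hf : Integrable f P) (hf0 : 0 ≤ᵐ[P] f) :
    ∃ ν : Measure Ω, IsProbabilityMeasure ν ∧ ν ≪ P ∧ (f =ᵐ[P] 0 ∨ ∃ c : ℝ, 0 < c ∧
      (fun ω => (ν.rnDeriv P ω).toReal) =ᵐ[P] c • f) := by
  rcases (integral_nonneg_of_ae hf0).eq_or_lt with h0 | hpos
  -- A vanishing `f` cannot be normalized; `P` serves as an arbitrary choice, since the weight will
  -- be zero.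
  · exact ⟨P, inferInstance, Measure.AbsolutelyContinuous.rfl,
      Or.inl ((integral_eq_zero_iff_of_nonneg_ae hf0 hf).1 h0.symm)⟩
  · set c := (∫ ω, f ω ∂P)⁻¹ with hc
    have hcpos : 0 < c := inv_pos.2 hpos
    have hmeas : Measurable fun ω => ENNReal.ofReal (c * f ω) :=
      (hfm.const_mul c).ennreal_ofReal
    refine ⟨P.withDensity fun ω => ENNReal.ofReal (c * f ω), ⟨?_⟩,
      withDensity_absolutelyContinuous _ _, Or.inr ⟨c, hcpos, ?_⟩⟩
    · rw [withDensity_apply _ MeasurableSet.univ, Measure.restrict_univ,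
        ← ofReal_integral_eq_lintegral_ofReal (hf.const_mul c)
          (by filter_upwards [hf0] with ω h using mul_nonneg hcpos.le h),
        integral_const_mul, hc, inv_mul_cancel₀ hpos.ne', ENNReal.ofReal_one]
    · filter_upwards [Measure.rnDeriv_withDensity P hmeas, hf0] with ω h h0
      rw [h, ENNReal.toReal_ofReal (mul_nonneg hcpos.le h0)]
      rfl

/-- The normalizing constant cancels in the quotient. Where the conditional expectation of `f`
vanishes, so does `f`, hence the default value `1` plays no role. -/
lemma condExp_mul_condDensity_eq [IsProbabilityMeasure P] (hm : m ≤ mΩ) {Q : Fin d → Measure Ω}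
    {i : Fin d} {f : Ω → ℝ} (hf : Integrable f P) (hf0 : 0 ≤ᵐ[P] f)
    (h : f =ᵐ[P] 0 ∨ ∃ c : ℝ, 0 < c ∧ density P Q i =ᵐ[P] c • f) :
    (fun ω => condExp m P f ω * condDensity m P Q i ω) =ᵐ[P] f := by
  rcases h with h | ⟨c, hc, h⟩
  · have h1 : condExp m P f =ᵐ[P] 0 := (condExp_congr_ae h).trans (by rw [condExp_zero])
    filter_upwards [h, h1] with ω h h1
    rw [h1, h]; simp
  · have h1 : condExp m P (density P Q i) =ᵐ[P] c • condExp m P f :=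
      (condExp_congr_ae h).trans (condExp_smul c f m)
    filter_upwards [h, h1, eq_zero_of_condExp_nonpos hm hf hf0, condExp_nonneg (m := m) hf0]
      with ω h h1 h2 h3
    simp only [condDensity, h, h1, Pi.smul_apply, smul_eq_mul]
    by_cases hω : 0 < condExp m P f ω
    · rw [if_pos (mul_pos hc hω)]
      field_simp
    · have h0 : condExp m P f ω = 0 := le_antisymm (not_lt.1 hω) h3
      rw [h2 h0.le, h0, zero_mul]

/-- Every nonnegative `v ∈ L^q_d` that does not vanish on `M` comes from a dual variable. -/
theorem exists_dualVars_couplingVec [IsProbabilityMeasure P] [hpq : p.HolderConjugate q]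
    [Fact (1 ≤ p)] (hm : m ≤ mΩ) {M : Submodule ℝ (LpVec d p P)} (hM : M ≤ LpSub m d p P)
    {v : LpVec d q P} (hv : v ∈ nonneg d q P) (hvM : ∃ u ∈ M, pairing P v u ≠ 0) :
    ∃ x : dualVars m P M q, couplingVec m P x.1.1 x.1.2 =ᵐ[P] v := by
  have : q.HolderConjugate p := hpq.symm
  have hq1 : 1 ≤ q := ENNReal.HolderConjugate.one_le q p
  have hvi : Integrable v P := (Lp.memLp v).integrable hq1
  have hint : ∀ i, Integrable (fun ω => v ω i) P := fun i => hvi.eval_piLp i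
  have hmeas : ∀ i, Measurable fun ω => v ω i := fun i =>
    (EuclideanSpace.proj i : Vec d →L[ℝ] ℝ).continuous.measurable.comp
      (Lp.stronglyMeasurable v).measurable
  have hv0 : ∀ i, 0 ≤ᵐ[P] fun ω => v ω i := fun i => by filter_upwards [hv] with ω h using h i
  choose Q hQp hQac hQd using fun i => exists_prob_density (hmeas i) (hint i) (hv0 i)
  have hQ : IsVectorProb P Q := fun i => ⟨hQp i, hQac i⟩
  -- The weight is `w = E[v | m]`; the normalization of each `v_i` by its conditional expectation is
  -- then undone by `w_i`.
  have hwm : MemLp (condExp m P v) q P := (Lp.memLp v).condExp hq1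
  set w : LpVec d q P := hwm.toLp _
  have hwe : w =ᵐ[P] condExp m P v := hwm.coeFn_toLp
  have hwL : w ∈ LpSub m d q P := mem_lpMeas_iff_aestronglyMeasurable.2
    (stronglyMeasurable_condExp.aestronglyMeasurable.congr hwe.symm)
  have hwi : ∀ i, (fun ω => w ω i) =ᵐ[P] condExp m P fun ω => v ω i := fun i => by
    have := (EuclideanSpace.proj i : Vec d →L[ℝ] ℝ).comp_condExp_comm
      (m := m) hvi
    filter_upwards [hwe, this] with ω h1 h2
    rw [h1]
    exact h2
  have hcoup : couplingVec m P Q w =ᵐ[P] v := by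
    have hall : ∀ᵐ ω ∂P, ∀ i, w ω i * condDensity m P Q i ω = v ω i := ae_all_iff.2 fun i => by
      filter_upwards [hwi i, condExp_mul_condDensity_eq hm (hint i) (hv0 i) (hQd i)] with ω h1 h2
      rw [h1]; exact h2
    filter_upwards [hall] with ω h
    ext i
    exact h i
  have hc : MemLp (couplingVec m P Q w) q P := (memLp_congr_ae hcoup).2 (Lp.memLp v)
  have hpair : ∀ u ∈ M, pairing P w u = pairing P v u := fun u hu => by
    rw [← pairing_couplingVec hm hQ hwL hc (hM hu), pairing_congr_left hcoup]
  refine ⟨⟨(Q, w), hQ, ⟨⟨hwL, fun u hu => ?_⟩, fun hann => ?_⟩, hc, ?_⟩, hcoup⟩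
  · rw [hpair u hu.1]
    exact pairing_nonneg hv hu.2
  · obtain ⟨u, hu, hne⟩ := hvM
    exact hne (by rw [← hpair u hu]; exact hann.2 u hu)
  · filter_upwards [hcoup, hv] with ω h1 h2 i
    rw [h1]; exact h2 i

end Duality

/-! ### Translation between dual variables and continuous functionals -/

section Assembly

variable {Ω : Type*} {m mΩ : MeasurableSpace Ω} {P : Measure Ω} {d : ℕ} {p q : ℝ≥0∞}
  [Fact (1 ≤ p)] {M : Submodule ℝ (LpVec d p P)}

/-- The functional `X ↦ E[(diag(w) ξ^Q)ᵀ X]`, continuous for the topology of `L^p_d`. -/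
noncomputable def dualFunctional [hpq : p.HolderConjugate q] (x : dualVars m P M q) :
    @ContinuousLinearMap ℝ ℝ _ _ (RingHom.id ℝ) (LpVec d p P) (topo d p P) _ ℝ _ _ _ _ :=
  letI : q.HolderConjugate p := hpq.symm
  letI : Fact (1 ≤ q) := ⟨ENNReal.HolderConjugate.one_le q p⟩
  @ContinuousLinearMap.mk ℝ ℝ _ _ (RingHom.id ℝ) (LpVec d p P) (topo d p P) _ ℝ _ _ _ _
    (pairingLinear (x.2.2.2.1.toLp _)) (continuous_pairing _)

lemma isClosedConvexRiskMeasure_iff {R : LpVec d p P → Set (LpVec d p P)} :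
    IsClosedConvexRiskMeasure P M R
      ↔ @IsClosedConvexTranslative _ _ _ (topo d p P) M (nonneg d p P) R := by
  constructor
  · rintro ⟨⟨h1, h2, h3, h4⟩, h5, h6⟩
    exact @IsClosedConvexTranslative.mk _ _ _ (topo d p P) _ _ _ h1 h2 h3 h4 h5 h6
  · rintro ⟨h1, h2, h3, h4, h5, h6⟩
    exact ⟨⟨h1, h2, h3, h4⟩, h5, h6⟩

variable [hpq : p.HolderConjugate q]

lemma dualFunctional_apply (x : dualVars m P M q) (X : LpVec d p P) :
    dualFunctional x X = pairing P (couplingVec m P x.1.1 x.1.2) X :=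
  pairing_congr_left x.2.2.2.1.coeFn_toLp _

lemma dualFunctional_nonneg (x : dualVars m P M q) {X : LpVec d p P} (hX : X ∈ nonneg d p P) :
    0 ≤ dualFunctional x X := by
  rw [dualFunctional_apply]
  exact pairing_nonneg x.2.2.2.2 hX

variable [IsProbabilityMeasure P]

lemma dualFunctional_apply_condExpQ (hm : m ≤ mΩ) (x : dualVars m P M q) (X : LpVec d p P) :
    dualFunctional x X = pairing P x.1.2 (condExpQ m P x.1.1 X) := by
  rw [dualFunctional_apply, pairing_condExpQ hm x.2.1 x.2.2.1.1.1 x.2.2.2.1 x.2.2.2.2]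

lemma dualFunctional_apply_of_mem (hm : m ≤ mΩ) (x : dualVars m P M q) {u : LpVec d p P}
    (hu : u ∈ LpSub m d p P) : dualFunctional x u = pairing P x.1.2 u := by
  rw [dualFunctional_apply, pairing_couplingVec hm x.2.1 x.2.2.1.1.1 x.2.2.2.1 hu]

/-- This is where `w ∉ M^⊥` enters: on `M` the functional is the pairing with `w`. -/
lemma exists_dualFunctional_ne_zero (hm : m ≤ mΩ) (hM : M ≤ LpSub m d p P)
    (x : dualVars m P M q) : ∃ u ∈ M, dualFunctional x u ≠ 0 := by
  by_contra! h
  exact x.2.2.1.2 ⟨x.2.2.1.1.1, fun u hu => by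
    rw [← dualFunctional_apply_of_mem hm x (hM hu)]; exact h u hu⟩

/-- No separating functional is lost: each one produced by Hahn–Banach is realized by a dual
variable. -/
lemma exists_dualFunctional_eq (hm : m ≤ mΩ) (hM : M ≤ LpSub m d p P)
    (φ : @ContinuousLinearMap ℝ ℝ _ _ (RingHom.id ℝ) (LpVec d p P) (topo d p P) _ ℝ _ _ _ _)
    (hφ : ∀ X ∈ nonneg d p P, 0 ≤ φ X) (hφM : ∃ u ∈ M, φ u ≠ 0) :
    ∃ x : dualVars m P M q, dualFunctional x = φ := by
  obtain ⟨v, hv⟩ := letI := topo d p P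
    exists_pairing_of_positive (q := q) φ.toLinearMap φ.cont hφ
  replace hv : ∀ X, φ X = pairing P v X := hv
  obtain ⟨x, hx⟩ := exists_dualVars_couplingVec hm hM
    (nonneg_of_pairing_nonneg fun X hX => by rw [← hv]; exact hφ X hX)
    (by obtain ⟨u, hu, hne⟩ := hφM; exact ⟨u, hu, by rwa [← hv]⟩)
  refine ⟨x, DFunLike.ext _ _ fun X => ?_⟩
  rw [dualFunctional_apply, hv, pairing_congr_left hx]

lemma shiftedHalfSpace_eq (hm : m ≤ mΩ) (hM : M ≤ LpSub m d p P) (x : dualVars m P M q)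
    (X : LpVec d p P) : shiftedHalfSpace m P M x.1.1 x.1.2 X
      = @subHalfSpace _ _ _ (topo d p P) M (dualFunctional x) X := by
  ext u
  refine and_congr_right fun hu => ?_
  rw [dualFunctional_apply_condExpQ hm, dualFunctional_apply_of_mem hm x (hM hu)]

lemma halfSpace_eq (hm : m ≤ mΩ) (x : dualVars m P M q) : halfSpace m P p x.1.2
    = @coneHalfSpace _ _ _ (topo d p P) (LpSub m d p P) (dualFunctional x) := by
  ext u
  refine and_congr_right fun hu => ?_
  rw [dualFunctional_apply_of_mem hm x hu]

lemma isPenalty_iff (hm : m ≤ mΩ) {a : dualVars m P M q → Set (LpVec d p P)} :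
    IsPenalty m P M a ↔ @IsAbstractPenalty _ _ _ (topo d p P) _ M (LpSub m d p P) (nonneg d p P)
      dualFunctional a := by
  constructor
  · rintro ⟨h1, h2, h3, h4⟩
    exact @IsAbstractPenalty.mk _ _ _ (topo d p P) _ _ _ _ _ _ h1 h2 h3
      fun x => by rw [← halfSpace_eq hm x]; exact h4 x
  · rintro ⟨h1, h2, h3, h4⟩
    exact ⟨h1, h2, h3, fun x => by rw [halfSpace_eq hm x]; exact h4 x⟩

lemma hasDualRep_iff (hm : m ≤ mΩ) (hM : M ≤ LpSub m d p P)
    {R : LpVec d p P → Set (LpVec d p P)} {a : dualVars m P M q → Set (LpVec d p P)} :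
    HasDualRep m P M R a ↔ ∀ X, R X = ⋂ x,
      (a x + @subHalfSpace _ _ _ (topo d p P) M (dualFunctional x) (-X)) := by
  unfold HasDualRep
  simp only [shiftedHalfSpace_eq hm hM]

lemma minPenalty_eq (hm : m ≤ mΩ) (hM : M ≤ LpSub m d p P)
    (R : LpVec d p P → Set (LpVec d p P)) :
    minPenalty m P M (q := q) R
      = fun x => @abstractMinPenalty _ _ _ (topo d p P) M R (dualFunctional x) := by
  funext x
  unfold minPenalty abstractMinPenalty
  simp only [shiftedHalfSpace_eq hm hM]
  rfl

end Assembly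

end SetRisk

theorem mainTheorem2 {Ω : Type*} [mΩ : MeasurableSpace Ω] (P : MeasureTheory.Measure Ω)
    [MeasureTheory.IsProbabilityMeasure P] {T : ℕ}
    (ℱ : MeasureTheory.Filtration (Fin (T + 1)) mΩ) (hT : ℱ (Fin.last T) = mΩ)
    (t : Fin (T + 1)) (d : ℕ) (p q : ENNReal) [Fact (1 ≤ p)] (hpq : p.HolderConjugate q)
    (M : Submodule ℝ (SetRisk.LpVec d p P)) (hMt : M ≤ SetRisk.LpSub (ℱ t) d p P)
    (hMclosed : IsClosed[SetRisk.topo d p P] (M : Set (SetRisk.LpVec d p P)))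
    (hMpos : SetRisk.posCone P M ≠ {0})
    (R : SetRisk.LpVec d p P → Set (SetRisk.LpVec d p P))
    (hR : ∀ X, R X ∈ SetRisk.imageSpace P M) :
    (SetRisk.IsClosedConvexRiskMeasure P M R ↔
      ∃ a : SetRisk.dualVars (ℱ t) P M q → Set (SetRisk.LpVec d p P),
        SetRisk.IsPenalty (ℱ t) P M a ∧ SetRisk.HasDualRep (ℱ t) P M R a) ∧
    (SetRisk.IsClosedConvexRiskMeasure P M R →
      SetRisk.IsPenalty (ℱ t) P M (SetRisk.minPenalty (ℱ t) P M (q := q) R) ∧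
      SetRisk.HasDualRep (ℱ t) P M R (SetRisk.minPenalty (ℱ t) P M (q := q) R) ∧
      ∀ a : SetRisk.dualVars (ℱ t) P M q → Set (SetRisk.LpVec d p P),
        SetRisk.IsPenalty (ℱ t) P M a → SetRisk.HasDualRep (ℱ t) P M R a →
        ∀ x, SetRisk.minPenalty (ℱ t) P M R x ⊆ a x) := by
  have hm : ℱ t ≤ mΩ := ℱ.le t
  have hadd := SetRisk.topo_isTopologicalAddGroup (d := d) (p := p) (P := P)
  have hsmul := SetRisk.topo_continuousSMul (d := d) (p := p) (P := P)
  have hlc := SetRisk.topo_locallyConvexSpace (d := d) (p := p) (P := P)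
  have hK0 : (0 : SetRisk.LpVec d p P) ∈ SetRisk.nonneg d p P := by
    filter_upwards [Lp.coeFn_zero (SetRisk.Vec d) p P] with ω h i
    rw [h]; rfl
  have hK : ∀ k ∈ SetRisk.nonneg d p P, ∀ r : ℝ, 0 ≤ r → r • k ∈ SetRisk.nonneg d p P := by
    intro k hk r hr
    filter_upwards [hk, Lp.coeFn_smul r k] with ω h1 h2 i
    rw [h2]
    exact mul_nonneg hr (h1 i)
  have hRM : ∀ X, R X ⊆ M := fun X => (hR X).1
  have hc : ∀ x : SetRisk.dualVars (ℱ t) P M q, ∃ u ∈ M, SetRisk.dualFunctional x u ≠ 0 :=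
    SetRisk.exists_dualFunctional_ne_zero hm hMt
  have hcK : ∀ x : SetRisk.dualVars (ℱ t) P M q, ∀ k ∈ SetRisk.nonneg d p P,
      0 ≤ SetRisk.dualFunctional x k := fun x k hk => SetRisk.dualFunctional_nonneg x hk
  have hsurj := SetRisk.exists_dualFunctional_eq (q := q) hm hMt
  have hmin : SetRisk.IsClosedConvexRiskMeasure P M R →
      SetRisk.IsPenalty (ℱ t) P M (SetRisk.minPenalty (ℱ t) P M (q := q) R) ∧
      SetRisk.HasDualRep (ℱ t) P M R (SetRisk.minPenalty (ℱ t) P M (q := q) R) := fun h => by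
    rw [SetRisk.isClosedConvexRiskMeasure_iff] at h
    rw [SetRisk.isPenalty_iff hm, SetRisk.hasDualRep_iff hm hMt, SetRisk.minPenalty_eq hm hMt]
    -- The abstract theorems are to be applied for this topology, which differs from the norm
    -- topology in the weak* case.
    let _ := SetRisk.topo d p P
    exact ⟨h.isAbstractPenalty_min hK hRM hMclosed hc hsurj hK0 hcK,
      h.eq_iInter_abstractMinPenalty hK hRM hMclosed hc hsurj⟩
  refine ⟨⟨fun h => ⟨_, hmin h⟩, ?_⟩, fun h => ⟨(hmin h).1, (hmin h).2, ?_⟩⟩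
  · rintro ⟨a, ha, hrep⟩
    rw [SetRisk.isPenalty_iff hm] at ha
    rw [SetRisk.hasDualRep_iff hm hMt] at hrep
    rw [SetRisk.isClosedConvexRiskMeasure_iff]
    exact @SetRisk.IsAbstractPenalty.isClosedConvexTranslative _ _ _ (SetRisk.topo d p P) _ _ _ _ _
      hadd hsmul _ ha hMclosed hMt hcK hc _ hrep
  · intro a ha hrep x
    rw [SetRisk.isPenalty_iff hm] at ha
    rw [SetRisk.hasDualRep_iff hm hMt] at hrep
    rw [SetRisk.minPenalty_eq hm hMt]
    exact @SetRisk.abstractMinPenalty_subset _ _ _ (SetRisk.topo d p P) _ _ _ _ _ _ ha hMt _ hrep x
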